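/- Conventions. Let $d\ge 1$; functions on $\mathbb R^d$ are real-valued, measurable, and identified when equal a.e.; $L^0(\mathbb R^d)$ is the space of all of them. Cubes are half-open with sides parallel to the axes, $\langle f\rangle_Q=\frac1{|Q|}\int_Q f$, $\langle f\rangle_{1,Q}=\frac1{|Q|}\int_Q|f|$, $\langle f\rangle_{\infty,Q}=\operatorname{ess\,sup}_Q|f|$, and $\|g\|_{L^{1,\infty}(Q)}=\sup_{t>0}t\,|\{x\in Q:|g(x)|>t\}|$. Set $$Mf=\sup_Q\langle f\rangle_{1,Q}\mathbf 1_Q,\qquad M^\sharp f=\sup_Q\langle f-\langle f\rangle_Q\rangle_{1,Q}\mathbf 1_Q,\qquad M^\sharp_{wk}f=\sup_Q\inf_{c\in\mathbb R}|Q|^{-1}\|f-c\|_{L^{1,\infty}(Q)}\mathbf 1_Q .$$ A weight is a measurable $w$ with $0<w<\infty$ a.e.; $[v]_{A_1}=\sup_Q\langle v\rangle_{1,Q}\langle v^{-1}\rangle_{\infty,Q}$, and $v\in A_1$ means $[v]_{A_1}<\infty$. Let $\|f\|_{L^\infty_w}=\|fw\|_{L^\infty}$, $$\|f\|_{BMO^\infty_w}=\sup_Q\langle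 w\rangle_{\infty,Q}\langle f-\langle f\rangle_Q\rangle_{1,Q},\qquad \|f\|_{BMO^{\infty,wk}_w}=\sup_Q\inf_{c\in\mathbb R}\langle w\rangle_{\infty,Q}|Q|^{-1}\|f-c\|_{L^{1,\infty}(Q)} .$$ (If $f$ is not integrable on $Q$, its mean oscillation on $Q$ is $\infty$.) A function norm is a map $\rho$ from the measurable functions $\mathbb R^d\to[0,\infty]$ to $[0,\infty]$ such that $\rho(f)=0$ iff $f=0$ a.e.; $\rho(f+g)\le\rho(f)+\rho(g)$ and $\rho(\lambda f)=\lambda\rho(f)$ for $\lambda\ge0$; $0\le f_n\uparrow f$ a.e. implies $\rho(f_n)\uparrow\rho(f)$; and every measurable set of positive measure contains a measurable set $F$ of positive measure with $\rho(\mathbf 1_F)<\infty$. The associated Banach function space is $X=\{f\in L^0(\mathbb R^d):\|f\|_X:=\rho(|f|)<\infty\}$; its Köthe dual $X'$ is given by $\|g\|_{X'}=\sup_{\|f\|_X=1}\|fg\|_{L^1}$. $X$ is order-continuous if $f_n\in X$, $f_n\downarrow0$ a.e. imply $\|f_n\|_X\to0$. We say that $f$ has level sets of finite measure if $|\{|f|>\alpha\}|<\infty$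 for every $\alpha>0$. Let $C_X$ and $C_{X,wk}$ be the least constants such that $$\|f\|_X\le C_X\|M^\sharp f\|_X,\qquad \|f\|_X\le C_{X,wk}\|M^\sharp_{wk}f\|_X$$ for all $f\in X$ with level sets of finite measure. An operator $T$ is sublinear if $|T(f+g)|\le|Tf|+|Tg|$ and $|T(\lambda f)|=|\lambda||Tf|$ a.e. Theorem. There is a constant $K=K(d)$ such that the following holds. Let $T$ be an operator in $L^0(\mathbb R^d)$, and let $\phi:[1,\infty)\to(0,\infty)$ be increasing (in the weak sense) such that for all weights $w$ with $w^{-1}\in A_1$ and all compactly supported $f\in L^\infty_w(\mathbb R^d)$ $$\|Tf\|_{BMO^\infty_w}\le\phi([w^{-1}]_{A_1})\,\|f\|_{L^\infty_w}.$$ Let $X$ be a Banach function space over $\mathbb R^d$ such that $M$ is bounded on $X$ and on $X'$. Then $C_X<\infty$, and for all compactly supported $f\in X$ such that $Tf$ has level sets of finite measure, $$\|Tf\|_X\le K\,C_X\,\phi(2\|M\|_{X\to X})\|f\|_X\quad\text{and}\quad \|Tf\|_X\le K\,\|M\|_{X'\to X'}\,\phi(2\|M\|_{X\to X})\|f\|_X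 .$$ If moreover $X$ is order-continuous, $Tf$ has level sets of finite measure for every compactly supported $f\in X$, and $T$ is sublinear (respectively linear) on the compactly supported functions in $X$, then the restriction of $T$ to these functions extends to a sublinear (respectively linear) operator $S:X\to X$ with $$\|Sf\|_X\le K\,C_X\,\phi(2\|M\|_{X\to X})\|f\|_X\quad\text{and}\quad \|Sf\|_X\le K\,\|M\|_{X'\to X'}\,\phi(2\|M\|_{X\to X})\|f\|_X\qquad(f\in X).$$ The same holds (with the same $K$) when $BMO^\infty_w$ is replaced by $BMO^{\infty,wk}_w$ and $C_X$ by $C_{X,wk}$. -/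

import Mathlib

open MeasureTheory Set Filter Topology
open scoped ENNReal NNReal

noncomputable section

namespace BMOExtrapolation

/-- `L⁰(ℝᵈ)`: real measurable functions on `ℝᵈ` modulo equality almost everywhere
with respect to Lebesgue measure. -/
abbrev L0 (d : ℕ) : Type := (Fin d → ℝ) →ₘ[(volume : Measure (Fin d → ℝ))] ℝ

/-- `f` vanishes almost everywhere outside some compact set. -/
def CompactlySupported {d : ℕ} (f : L0 d) : Prop :=
  ∃ K : Set (Fin d → ℝ), IsCompact K ∧ ∀ᵐ x ∂volume, x ∉ K → f x = 0

/-- `|{x : |f x| > α}| < ∞` for every `α > 0`. -/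
def FiniteLevelSets {d : ℕ} (f : L0 d) : Prop :=
  ∀ α : ℝ, 0 < α → volume {x | α < |f x|} < ∞

/-! ### Cubes and maximal operators -/

/-- A half-open cube with sides parallel to the coordinate axes. -/
structure Cube (d : ℕ) where
  corner : Fin d → ℝ
  side : ℝ
  side_pos : 0 < side

/-- The points of a cube. -/
def Cube.carrier {d : ℕ} (Q : Cube d) : Set (Fin d → ℝ) :=
  Set.pi univ fun i => Ico (Q.corner i) (Q.corner i + Q.side)

/-- The Hardy-Littlewood maximal operator `sup_Q ⟨f⟩_{1,Q} 𝟙_Q`, written for `[0,∞]`-valued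
functions (it depends on `|f|` only). -/
def maximal {d : ℕ} (f : (Fin d → ℝ) → ℝ≥0∞) (x : Fin d → ℝ) : ℝ≥0∞ :=
  ⨆ Q : Cube d, Q.carrier.indicator (fun _ => ⨍⁻ y in Q.carrier, f y ∂volume) x

/-- The mean oscillation `⟨f - ⟨f⟩_Q⟩_{1,Q}`. It is `∞` when `f` is not integrable on `Q`,
whatever the value of `⟨f⟩_Q`. -/
def oscillation {d : ℕ} (f : L0 d) (Q : Cube d) : ℝ≥0∞ :=
  ⨍⁻ x in Q.carrier, ‖f x - ⨍ y in Q.carrier, f y ∂volume‖ₑ ∂volume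

/-- The weak `L¹` quasinorm `sup_{t > 0} t |{x ∈ Q : |g x| > t}|`. -/
def weakL1 {d : ℕ} (g : (Fin d → ℝ) → ℝ) (Q : Cube d) : ℝ≥0∞ :=
  ⨆ t : ℝ≥0, (t : ℝ≥0∞) * volume {x | x ∈ Q.carrier ∧ (t : ℝ) < |g x|}

/-- The weak mean oscillation `inf_c |Q|⁻¹ ‖(f - c) 𝟙_Q‖_{L^{1,∞}(Q)}`. -/
def weakOscillation {d : ℕ} (f : L0 d) (Q : Cube d) : ℝ≥0∞ :=
  ⨅ c : ℝ, (volume Q.carrier)⁻¹ * weakL1 (fun x => f x - c) Q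

/-- The sharp maximal operator `M^♯`. -/
def sharpMaximal {d : ℕ} (f : L0 d) (x : Fin d → ℝ) : ℝ≥0∞ :=
  ⨆ Q : Cube d, Q.carrier.indicator (fun _ => oscillation f Q) x

/-- The weak sharp maximal operator `M^♯_wk`. -/
def weakSharpMaximal {d : ℕ} (f : L0 d) (x : Fin d → ℝ) : ℝ≥0∞ :=
  ⨆ Q : Cube d, Q.carrier.indicator (fun _ => weakOscillation f Q) x

/-! ### Weights and weighted spaces -/

/-- A weight is a measurable function with `0 < w < ∞` almost everywhere. -/
def IsWeight {d : ℕ} (w : (Fin d → ℝ) → ℝ) : Prop :=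
  Measurable w ∧ ∀ᵐ x ∂volume, 0 < w x

/-- `⟨w⟩_{∞,Q}`, the essential supremum of `|w|` on `Q`. -/
def essSupOn {d : ℕ} (w : (Fin d → ℝ) → ℝ) (Q : Cube d) : ℝ≥0∞ :=
  essSup (fun x => ‖w x‖ₑ) (volume.restrict Q.carrier)

/-- `[v]_{A₁} = sup_Q ⟨v⟩_{1,Q} ⟨v⁻¹⟩_{∞,Q}`; a weight `v` is in `A₁` when this is finite. -/
def A1Const {d : ℕ} (v : (Fin d → ℝ) → ℝ) : ℝ≥0∞ :=
  ⨆ Q : Cube d, (⨍⁻ x in Q.carrier, ‖v x‖ₑ ∂volume) * essSupOn (fun x => (v x)⁻¹) Q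

/-- `‖f‖_{L^∞_w} = ‖f w‖_{L^∞}`. -/
def weightedLinfty {d : ℕ} (w : (Fin d → ℝ) → ℝ) (f : L0 d) : ℝ≥0∞ :=
  essSup (fun x => ‖f x * w x‖ₑ) volume

/-- `‖f‖_{BMO^∞_w}`. -/
def bmoNorm {d : ℕ} (w : (Fin d → ℝ) → ℝ) (f : L0 d) : ℝ≥0∞ :=
  ⨆ Q : Cube d, essSupOn w Q * oscillation f Q

/-- `‖f‖_{BMO^{∞,wk}_w}`. -/
def weakBmoNorm {d : ℕ} (w : (Fin d → ℝ) → ℝ) (f : L0 d) : ℝ≥0∞ :=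
  ⨆ Q : Cube d, essSupOn w Q * weakOscillation f Q

/-! ### Banach function spaces -/

/-- A function norm on the nonnegative measurable functions on `ℝᵈ`. The values of `toFun` on
non-measurable functions play no role. -/
structure FunctionNorm (d : ℕ) where
  toFun : ((Fin d → ℝ) → ℝ≥0∞) → ℝ≥0∞
  eq_zero_iff : ∀ f, Measurable f → (toFun f = 0 ↔ f =ᵐ[volume] 0)
  add_le : ∀ f g, Measurable f → Measurable g → toFun (f + g) ≤ toFun f + toFun g
  smul_eq : ∀ (c : ℝ≥0) f, Measurable f → toFun (fun x => c * f x) = c * toFun f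
  /-- The Fatou property. -/
  fatou : ∀ (u : ℕ → (Fin d → ℝ) → ℝ≥0∞) (f : (Fin d → ℝ) → ℝ≥0∞),
    (∀ n, Measurable (u n)) → Measurable f →
    (∀ᵐ x ∂volume, Monotone fun n => u n x) →
    (∀ᵐ x ∂volume, Tendsto (fun n => u n x) atTop (𝓝 (f x))) →
    toFun f = ⨆ n, toFun (u n)
  /-- The saturation property. -/
  saturated : ∀ E : Set (Fin d → ℝ), MeasurableSet E → 0 < volume E →
    ∃ F ⊆ E, MeasurableSet F ∧ 0 < volume F ∧ toFun (F.indicator 1) < ∞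

namespace FunctionNorm

variable {d : ℕ} (X : FunctionNorm d)

/-- `‖f‖_X`, equal to `∞` when `f ∉ X`. -/
def norm (f : L0 d) : ℝ≥0∞ := X.toFun fun x => ‖f x‖ₑ

theorem toFun_mono {f g : (Fin d → ℝ) → ℝ≥0∞} (hf : Measurable f) (hg : Measurable g)
    (h : ∀ᵐ x ∂volume, f x ≤ g x) : X.toFun f ≤ X.toFun g := by
  have key := X.fatou (fun n => if n = 0 then f else g) g
    (by intro n; by_cases hn : n = 0 <;> simp [hn, hf, hg]) hg
    (by
      filter_upwards [h] with x hx
      refine monotone_nat_of_le_succ fun n => ?_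
      by_cases hn : n = 0 <;> simp [hn, hx])
    (by
      refine Eventually.of_forall fun x => tendsto_const_nhds.congr' ?_
      filter_upwards [eventually_ge_atTop 1] with n hn
      simp [Nat.one_le_iff_ne_zero.mp hn])
  rw [key]
  exact le_iSup_of_le 0 (by simp)

/-- The Banach function space of all `f ∈ L⁰(ℝᵈ)` with `‖f‖_X < ∞`. -/
def space : Submodule ℝ (L0 d) where
  carrier := {f | X.norm f < ∞}
  zero_mem' := by
    have hm : Measurable fun x => ‖(0 : L0 d) x‖ₑ := (AEEqFun.measurable _).enorm
    have h0 : X.norm (0 : L0 d) = 0 := by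
      refine (X.eq_zero_iff _ hm).2 ?_
      filter_upwards [AEEqFun.coeFn_zero (α := Fin d → ℝ) (μ := volume) (β := ℝ)] with x hx
      simp [hx]
    simp [h0]
  add_mem' := by
    intro f g hf hg
    have mf : Measurable fun x => ‖f x‖ₑ := (AEEqFun.measurable f).enorm
    have mg : Measurable fun x => ‖g x‖ₑ := (AEEqFun.measurable g).enorm
    have ms : Measurable fun x => ‖(f + g) x‖ₑ := (AEEqFun.measurable (f + g)).enorm
    refine lt_of_le_of_lt ((X.toFun_mono ms (mf.add mg) ?_).trans
      (X.add_le _ _ mf mg)) (ENNReal.add_lt_top.2 ⟨hf, hg⟩)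
    filter_upwards [AEEqFun.coeFn_add f g] with x hx
    rw [hx]
    exact enorm_add_le _ _
  smul_mem' := by
    intro c f hf
    have mf : Measurable fun x => ‖f x‖ₑ := (AEEqFun.measurable f).enorm
    have ms : Measurable fun x => ‖(c • f) x‖ₑ := (AEEqFun.measurable (c • f)).enorm
    have mc : Measurable fun x => ((‖c‖₊ : ℝ≥0) : ℝ≥0∞) * ‖f x‖ₑ := mf.const_mul _
    refine lt_of_le_of_lt ((X.toFun_mono ms mc ?_).trans (X.smul_eq ‖c‖₊ _ mf).le)
      (ENNReal.mul_lt_top ENNReal.coe_lt_top hf)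
    filter_upwards [AEEqFun.coeFn_smul c f] with x hx
    rw [hx, Pi.smul_apply, smul_eq_mul, enorm_mul]
    exact le_rfl

/-- The associate function norm `ρ'(g) = sup_{ρ(f) = 1} ‖f g‖_{L¹}`, which defines the Köthe
dual `X'`. -/
def dual (g : (Fin d → ℝ) → ℝ≥0∞) : ℝ≥0∞ :=
  ⨆ (f : (Fin d → ℝ) → ℝ≥0∞) (_ : Measurable f) (_ : X.toFun f = 1), ∫⁻ x, f x * g x ∂volume

/-- `X` is order-continuous: `f_n ∈ X` and `f_n ↓ 0` a.e. imply `‖f_n‖_X → 0`. -/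
def OrderContinuous : Prop :=
  ∀ f : ℕ → L0 d, (∀ n, f n ∈ X.space) → Antitone f →
    (∀ᵐ x ∂volume, Tendsto (fun n => f n x) atTop (𝓝 0)) →
    Tendsto (fun n => X.norm (f n)) atTop (𝓝 0)

/-- The compactly supported elements of `X`. -/
def compactPart : Set (L0 d) := {f | f ∈ X.space ∧ CompactlySupported f}

/-- `C_X`: the least constant with `‖f‖_X ≤ C_X ‖M^♯ f‖_X` for all `f ∈ X` with level sets of
finite measure (`∞` if there is none). -/
def sharpConst : ℝ≥0∞ :=
  sInf {C | ∀ f ∈ X.space, FiniteLevelSets f → X.norm f ≤ C * X.toFun (sharpMaximal f)}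

/-- `C_{X,wk}`: the least constant with `‖f‖_X ≤ C_{X,wk} ‖M^♯_wk f‖_X` for all `f ∈ X` with
level sets of finite measure (`∞` if there is none). -/
def weakSharpConst : ℝ≥0∞ :=
  sInf {C | ∀ f ∈ X.space, FiniteLevelSets f → X.norm f ≤ C * X.toFun (weakSharpMaximal f)}

end FunctionNorm

/-- The operator norm of `M` on the space of measurable functions with `ρ(|f|) < ∞`; `M` is
bounded on that space exactly when this is finite. -/
def maximalOpNorm {d : ℕ} (ρ : ((Fin d → ℝ) → ℝ≥0∞) → ℝ≥0∞) : ℝ≥0∞ :=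
  sInf {C | ∀ f, Measurable f → ρ f < ∞ → ρ (maximal f) ≤ C * ρ f}

/-! ### Operators -/

/-- `T` is sublinear on a set `D` of functions (to be used for linear subspaces `D`). -/
def SublinearOn {d : ℕ} (T : L0 d → L0 d) (D : Set (L0 d)) : Prop :=
  (∀ f ∈ D, ∀ g ∈ D, ∀ᵐ x ∂volume, |T (f + g) x| ≤ |T f x| + |T g x|) ∧
  ∀ (c : ℝ), ∀ f ∈ D, ∀ᵐ x ∂volume, |T (c • f) x| = |c| * |T f x|

/-- `T` is linear on a set `D` of functions (to be used for linear subspaces `D`). -/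
def LinearOn {d : ℕ} (T : L0 d → L0 d) (D : Set (L0 d)) : Prop :=
  (∀ f ∈ D, ∀ g ∈ D, T (f + g) = T f + T g) ∧ ∀ (c : ℝ), ∀ f ∈ D, T (c • f) = c • T f

/-- For all `w⁻¹ ∈ A₁` and all compactly supported `f ∈ L^∞_w`,
`N w (T f) ≤ φ([w⁻¹]_{A₁}) ‖f‖_{L^∞_w}`, where `N w` is a weighted `BMO` norm. -/
def WeightedBound {d : ℕ} (N : ((Fin d → ℝ) → ℝ) → L0 d → ℝ≥0∞) (φ : ℝ → ℝ)
    (T : L0 d → L0 d) : Prop :=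
  ∀ w : (Fin d → ℝ) → ℝ, IsWeight w → A1Const w⁻¹ < ∞ →
    ∀ f : L0 d, CompactlySupported f → weightedLinfty w f < ∞ →
      N w (T f) ≤ ENNReal.ofReal (φ (A1Const w⁻¹).toReal) * weightedLinfty w f

/-- `‖T f‖_X ≤ B ‖f‖_X` for every compactly supported `f ∈ X` such that `T f` has level sets of
finite measure. -/
def BoundedOnCompactPart {d : ℕ} (X : FunctionNorm d) (T : L0 d → L0 d) (B : ℝ≥0∞) : Prop :=
  ∀ f ∈ X.compactPart, FiniteLevelSets (T f) → X.norm (T f) ≤ B * X.norm f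

/-- If `X` is order-continuous and `T f` has level sets of finite measure for all compactly
supported `f ∈ X`, then a (sub)linear `T` extends to a (sub)linear operator `S : X → X` with
`‖S f‖_X ≤ B ‖f‖_X` and `‖S f‖_X ≤ B' ‖f‖_X` for all `f ∈ X`. -/
def ExtendsBoundedly {d : ℕ} (X : FunctionNorm d) (T : L0 d → L0 d) (B B' : ℝ≥0∞) : Prop :=
  X.OrderContinuous → (∀ f ∈ X.compactPart, FiniteLevelSets (T f)) →
    (SublinearOn T X.compactPart →
      ∃ S : L0 d → L0 d, SublinearOn S X.space ∧ (∀ f ∈ X.space, S f ∈ X.space) ∧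
        (∀ f ∈ X.compactPart, S f = T f) ∧
        ∀ f ∈ X.space, X.norm (S f) ≤ B * X.norm f ∧ X.norm (S f) ≤ B' * X.norm f) ∧
    (LinearOn T X.compactPart →
      ∃ S : X.space →ₗ[ℝ] X.space,
        (∀ f : X.space, CompactlySupported (f : L0 d) → (S f : L0 d) = T f) ∧
        ∀ f : X.space, X.norm (S f) ≤ B * X.norm f ∧ X.norm (S f) ≤ B' * X.norm f)

end BMOExtrapolation

end

open BMOExtrapolation

noncomputable section

namespace BMOExtrapolation

/-! ### Cubes and measurability of the maximal operators -/

namespace Cube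

variable {d : ℕ}

/-! Extrapolation. The Rubio de Francia series `v = ∑ (2‖M‖)⁻ᵏ Mᵏ|f|` satisfies `|f| ≤ v`, `‖v‖_X ≤
2‖f‖_X` and `Mv ≤ 2‖M‖ v` (`FunctionNorm.exists_rubioDeFrancia`). Hence `w = v⁻¹` is an admissible
weight with `[w⁻¹]_{A₁} ≤ 2‖M‖` and `‖f‖_{L^∞_w} ≤ 1`. The assumed bound says that `ess sup_Q w`
times the oscillation of `Tf` on `Q` is at most `φ(2‖M‖)` for all `Q`. For almost every `x`, `w(x) ≤
ess sup_Q w` for all cubes `Q ∋ x` at once (`ae_forall_le_essSupOn`), so the sharp maximal function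
of `Tf` is at most `φ(2‖M‖) v` almost everywhere (`exists_majorant`). Its norm in `X` is therefore
at most `2φ(2‖M‖)‖f‖_X`.

Fefferman-Stein. It remains to control a function by its sharp maximal function. By duality (`X'' =
X`, `FunctionNorm.toFun_le_of_lintegral_mul_le`) this reduces to `∫ |h| g ≤ 2^(d+4) ∫ (M^♯_wk h)(M
g)` for `h` with level sets of finite measure (`lintegral_enorm_mul_le`). On a cube the inequality
follows by iterating a Calderón-Zygmund decomposition (`oscPairing_step`, `oscPairing_le`). The
result needs no a priori membership of `h` in `X`; it gives finiteness of the sharp constants, the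
bound with `‖M‖_{X'}`, and `Tf ∈ X`, after which the definition of the sharp constant gives the
other bound.

Extension. Order continuity makes the cut-offs of `f` to balls converge to `f` in `X`. A linear `T`
is Lipschitz on compactly supported functions and extends by completeness. For a sublinear `T` this
is true only of `|T|`, and the extension is built from the limits of `|T|` (`extends_linear`,
`extends_sublinear`). -/

theorem mem_carrier {Q : Cube d} {x : Fin d → ℝ} :
    x ∈ Q.carrier ↔ ∀ i, Q.corner i ≤ x i ∧ x i < Q.corner i + Q.side := by
  simp [carrier, Set.mem_pi]

theorem measurableSet_carrier (Q : Cube d) : MeasurableSet Q.carrier :=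
  MeasurableSet.univ_pi fun _ => measurableSet_Ico

theorem volume_carrier (Q : Cube d) : volume Q.carrier = ENNReal.ofReal Q.side ^ d := by
  simp [carrier, Real.volume_pi_Ico]

theorem volume_pos (Q : Cube d) : 0 < volume Q.carrier := by
  rw [volume_carrier]
  exact ENNReal.pow_pos (by simpa using Q.side_pos) d

theorem volume_ne_zero (Q : Cube d) : volume Q.carrier ≠ 0 := Q.volume_pos.ne'

theorem volume_ne_top (Q : Cube d) : volume Q.carrier ≠ ∞ := by
  rw [volume_carrier]; exact ENNReal.pow_ne_top ENNReal.ofReal_ne_top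

theorem volume_lt_top (Q : Cube d) : volume Q.carrier < ∞ := Q.volume_ne_top.lt_top

instance isFiniteMeasure_restrict (Q : Cube d) :
    IsFiniteMeasure ((volume : Measure (Fin d → ℝ)).restrict Q.carrier) :=
  ⟨by simpa using Q.volume_lt_top⟩

/-- The cube obtained by moving the lower left corner by `1 / (n + 1)` in all coordinates. -/
def enlarge (Q : Cube d) (n : ℕ) : Cube d where
  corner i := Q.corner i - 1 / ((n : ℝ) + 1)
  side := Q.side + 1 / ((n : ℝ) + 1)
  side_pos := add_pos Q.side_pos (by positivity)

theorem mem_enlarge {Q : Cube d} {n : ℕ} {x : Fin d → ℝ} :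
    x ∈ (Q.enlarge n).carrier ↔
      ∀ i, Q.corner i - 1 / ((n : ℝ) + 1) ≤ x i ∧ x i < Q.corner i + Q.side := by
  rw [mem_carrier]
  refine forall_congr' fun i => and_congr Iff.rfl ?_
  simp only [enlarge]
  rw [sub_add_add_cancel]

theorem carrier_subset_enlarge (Q : Cube d) (n : ℕ) : Q.carrier ⊆ (Q.enlarge n).carrier := by
  intro x hx
  rw [mem_carrier] at hx
  rw [mem_enlarge]
  intro i
  have : 0 < 1 / ((n : ℝ) + 1) := by positivity
  exact ⟨by linarith [(hx i).1], (hx i).2⟩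

theorem enlarge_mem_nhds {Q : Cube d} {x : Fin d → ℝ} (hx : x ∈ Q.carrier) (n : ℕ) :
    (Q.enlarge n).carrier ∈ 𝓝 x := by
  rw [mem_carrier] at hx
  have hpos : 0 < 1 / ((n : ℝ) + 1) := by positivity
  have : Set.pi univ (fun i => Ioo (Q.corner i - 1 / ((n : ℝ) + 1)) (Q.corner i + Q.side)) ∈ 𝓝 x :=
    set_pi_mem_nhds finite_univ fun i _ => Ioo_mem_nhds (by linarith [(hx i).1]) (hx i).2
  refine mem_of_superset this fun y hy => ?_
  rw [mem_enlarge]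
  exact fun i => ⟨(hy i trivial).1.le, (hy i trivial).2⟩

theorem antitone_enlarge (Q : Cube d) : Antitone fun n => (Q.enlarge n).carrier := by
  intro m n hmn x hx
  rw [mem_enlarge] at hx ⊢
  have : 1 / ((n : ℝ) + 1) ≤ 1 / ((m : ℝ) + 1) := Nat.one_div_le_one_div hmn
  exact fun i => ⟨by linarith [(hx i).1], (hx i).2⟩

theorem iInter_enlarge (Q : Cube d) : ⋂ n, (Q.enlarge n).carrier = Q.carrier := by
  refine subset_antisymm (fun x hx => ?_) (subset_iInter Q.carrier_subset_enlarge)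
  simp only [mem_iInter, mem_enlarge] at hx
  rw [mem_carrier]
  refine fun i => ⟨?_, (hx 0 i).2⟩
  have h : Tendsto (fun n : ℕ => Q.corner i - 1 / ((n : ℝ) + 1)) atTop (𝓝 (Q.corner i - 0)) :=
    tendsto_const_nhds.sub tendsto_one_div_add_atTop_nhds_zero_nat
  rw [sub_zero] at h
  exact le_of_tendsto' h fun n => (hx n i).1

theorem tendsto_volume_enlarge (Q : Cube d) :
    Tendsto (fun n => volume (Q.enlarge n).carrier) atTop (𝓝 (volume Q.carrier)) := by
  conv => arg 3; rw [← Q.iInter_enlarge]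
  exact tendsto_measure_iInter_atTop
    (fun n => (Q.enlarge n).measurableSet_carrier.nullMeasurableSet) Q.antitone_enlarge
    ⟨0, (Q.enlarge 0).volume_ne_top⟩

/-- The cube `∏ [x i, x i + s)`. -/
def of (x : Fin d → ℝ) (s : ℝ) (hs : 0 < s) : Cube d := ⟨x, s, hs⟩

theorem mem_of (x : Fin d → ℝ) (s : ℝ) (hs : 0 < s) : x ∈ (of x s hs).carrier := by
  rw [mem_carrier]; exact fun i => ⟨le_rfl, lt_add_of_pos_right _ hs⟩

theorem carrier_ae_eq_closedBall (Q : Cube d) :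
    Q.carrier =ᵐ[volume] Metric.closedBall (fun i => Q.corner i + Q.side / 2) (Q.side / 2) := by
  rw [closedBall_pi _ (by linarith [Q.side_pos])]
  refine (Measure.univ_pi_Ico_ae_eq_Icc (μ := fun _ : Fin d => (volume : Measure ℝ))).trans ?_
  refine Eq.eventuallyEq ?_
  rw [← Set.pi_univ_Icc]
  refine Set.pi_congr rfl fun i _ => ?_
  rw [Real.closedBall_eq_Icc]
  congr 1 <;> ring

end Cube

variable {d : ℕ}

/-- A point of a half-open cube may lie on a lower face, but it is interior to every enlargement of
the cube. If `a` stays above `t` for some enlargement, the supremum stays above `t` in a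
neighbourhood. This settles measurability although the supremum runs over uncountably many cubes. -/
theorem lowerSemicontinuous_iSup_indicator {a : Cube d → ℝ≥0∞}
    (ha : ∀ Q t, t < a Q → ∃ n, t < a (Q.enlarge n)) :
    LowerSemicontinuous fun x => ⨆ Q : Cube d, Q.carrier.indicator (fun _ => a Q) x := by
  intro x t ht
  obtain ⟨Q, hQ⟩ := lt_iSup_iff.1 ht
  have hx : x ∈ Q.carrier := by
    by_contra hx
    simp [indicator_of_notMem hx] at hQ
  rw [indicator_of_mem hx] at hQ
  obtain ⟨n, hn⟩ := ha Q t hQ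
  filter_upwards [Cube.enlarge_mem_nhds hx n] with y hy
  refine hn.trans_le (le_iSup_of_le (Q.enlarge n) ?_)
  rw [indicator_of_mem hy]

theorem le_iSup_indicator (a : Cube d → ℝ≥0∞) {Q : Cube d} {x : Fin d → ℝ}
    (hx : x ∈ Q.carrier) : a Q ≤ ⨆ Q : Cube d, Q.carrier.indicator (fun _ => a Q) x :=
  le_iSup_of_le Q (by rw [indicator_of_mem hx])

theorem iSup_indicator_le {a : Cube d → ℝ≥0∞} {x : Fin d → ℝ} {b : ℝ≥0∞}
    (h : ∀ Q : Cube d, x ∈ Q.carrier → a Q ≤ b) :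
    ⨆ Q : Cube d, Q.carrier.indicator (fun _ => a Q) x ≤ b := by
  refine iSup_le fun Q => ?_
  by_cases hx : x ∈ Q.carrier
  · rw [indicator_of_mem hx]; exact h Q hx
  · simp [indicator_of_notMem hx]

theorem lowerSemicontinuous_maximal (f : (Fin d → ℝ) → ℝ≥0∞) :
    LowerSemicontinuous (maximal f) := by
  refine lowerSemicontinuous_iSup_indicator fun Q t ht => ?_
  rw [setLAverage_eq] at ht
  have h : Tendsto (fun n => (∫⁻ y in Q.carrier, f y) / volume (Q.enlarge n).carrier) atTop
      (𝓝 ((∫⁻ y in Q.carrier, f y) / volume Q.carrier)) :=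
    ENNReal.Tendsto.const_div Q.tendsto_volume_enlarge (Or.inl Q.volume_ne_top)
  obtain ⟨n, hn⟩ := (h.eventually (lt_mem_nhds ht)).exists
  refine ⟨n, hn.trans_le ?_⟩
  rw [setLAverage_eq]
  gcongr
  exact Q.carrier_subset_enlarge n

theorem measurable_maximal (f : (Fin d → ℝ) → ℝ≥0∞) : Measurable (maximal f) :=
  (lowerSemicontinuous_maximal f).measurable

theorem weakL1_mono_cube {g : (Fin d → ℝ) → ℝ} {Q Q' : Cube d} (h : Q.carrier ⊆ Q'.carrier) :
    weakL1 g Q ≤ weakL1 g Q' := by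
  refine iSup_mono fun t => ?_
  gcongr

theorem measurable_weakSharpMaximal (f : L0 d) : Measurable (weakSharpMaximal f) := by
  refine (lowerSemicontinuous_iSup_indicator fun Q t ht => ?_).measurable
  have h : Tendsto (fun n => t * volume (Q.enlarge n).carrier) atTop
      (𝓝 (t * volume Q.carrier)) :=
    ENNReal.Tendsto.const_mul Q.tendsto_volume_enlarge (Or.inl Q.volume_ne_zero)
  obtain ⟨s, hts, hs⟩ := exists_between ht
  have hlt : t * volume Q.carrier < s * volume Q.carrier :=
    ENNReal.mul_lt_mul_left Q.volume_ne_zero Q.volume_ne_top hts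
  obtain ⟨n, hn⟩ := (h.eventually (gt_mem_nhds hlt)).exists
  refine ⟨n, ?_⟩
  have hV := (Q.enlarge n).volume_ne_zero
  have hV' := (Q.enlarge n).volume_ne_top
  have : s * volume Q.carrier / volume (Q.enlarge n).carrier ≤ weakOscillation f (Q.enlarge n) := by
    refine le_iInf fun c => ?_
    rw [ENNReal.div_eq_inv_mul]
    gcongr
    refine le_trans ?_ (weakL1_mono_cube (Q.carrier_subset_enlarge n))
    have := hs.le.trans (iInf_le _ c)
    rwa [← ENNReal.div_eq_inv_mul, ENNReal.le_div_iff_mul_le (Or.inl Q.volume_ne_zero)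
      (Or.inl Q.volume_ne_top)] at this
  refine lt_of_lt_of_le ?_ this
  rwa [ENNReal.lt_div_iff_mul_lt (Or.inl hV) (Or.inl hV')]

theorem oscillation_eq_top {f : L0 d} {Q : Cube d} (h : ¬ IntegrableOn f Q.carrier) :
    oscillation f Q = ∞ := by
  rw [oscillation, setLAverage_eq, ENNReal.div_eq_top]
  refine Or.inr ⟨?_, Q.volume_ne_top⟩
  by_contra hne
  refine h ?_
  have h1 : IntegrableOn (fun x => f x - ⨍ y in Q.carrier, f y) Q.carrier :=
    ⟨((AEEqFun.measurable f).sub measurable_const).aestronglyMeasurable, lt_top_iff_ne_top.2 hne⟩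
  refine (h1.add (integrable_const (⨍ y in Q.carrier, f y))).congr (Eventually.of_forall fun x => ?_)
  simp

theorem measurable_sharpMaximal (f : L0 d) : Measurable (sharpMaximal f) := by
  refine (lowerSemicontinuous_iSup_indicator fun Q t ht => ?_).measurable
  -- Without integrability on any enlargement, the oscillation there is already infinite.
  -- Integrability on one of them makes the means converge to the mean on `Q`, so that small
  -- oscillation on the enlargements would force small oscillation on `Q`.
  by_cases hint : ∀ n, ¬ IntegrableOn f (Q.enlarge n).carrier
  · exact ⟨0, by rw [oscillation_eq_top (hint 0)]; exact ht.trans_le le_top⟩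
  push Not at hint
  set m : ℕ → ℝ := fun n => ⨍ y in (Q.enlarge n).carrier, f y with hm
  set m' : ℝ := ⨍ y in Q.carrier, f y with hm'
  have hmlim : Tendsto m atTop (𝓝 m') := by
    have h1 := tendsto_setIntegral_of_antitone
      (fun n => (Q.enlarge n).measurableSet_carrier) Q.antitone_enlarge hint
    rw [Q.iInter_enlarge] at h1
    have h2 := (ENNReal.tendsto_toReal Q.volume_ne_top).comp Q.tendsto_volume_enlarge
    have h3 := (h2.inv₀ (ENNReal.toReal_pos Q.volume_ne_zero Q.volume_ne_top).ne').smul h1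
    simpa only [hm, hm', setAverage_eq, Measure.real, Function.comp_def] using h3
  have hden : Tendsto (fun n => ENNReal.ofReal |m n - m'|) atTop (𝓝 0) := by
    have : Tendsto (fun n => |m n - m'|) atTop (𝓝 0) := by
      simpa using (hmlim.sub_const m').abs
    simpa using ENNReal.tendsto_ofReal this
  have hlim : Tendsto (fun n => t * (volume (Q.enlarge n).carrier / volume Q.carrier)
      + ENNReal.ofReal |m n - m'|) atTop (𝓝 (t * 1 + 0)) := by
    refine Tendsto.add (ENNReal.Tendsto.const_mul ?_ (Or.inl one_ne_zero)) hden
    have := ENNReal.Tendsto.div_const Q.tendsto_volume_enlarge (b := volume Q.carrier)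
      (Or.inr Q.volume_ne_zero)
    rwa [ENNReal.div_self Q.volume_ne_zero Q.volume_ne_top] at this
  rw [mul_one, add_zero] at hlim
  obtain ⟨n, hn⟩ := (hlim.eventually (gt_mem_nhds ht)).exists
  refine ⟨n, ?_⟩
  by_contra hle
  rw [not_lt] at hle
  refine absurd hn (not_lt.2 ?_)
  have hV := (Q.enlarge n).volume_ne_zero
  have hV' := (Q.enlarge n).volume_ne_top
  rw [oscillation, setLAverage_eq] at hle ⊢
  have hle' : ∫⁻ x in (Q.enlarge n).carrier, ‖f x - m n‖ₑ ≤ t * volume (Q.enlarge n).carrier :=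
    (ENNReal.div_le_iff_le_mul (Or.inl hV) (Or.inl hV')).1 hle
  rw [ENNReal.div_le_iff_le_mul (Or.inl Q.volume_ne_zero) (Or.inl Q.volume_ne_top), add_mul,
    mul_assoc, ENNReal.div_mul_cancel Q.volume_ne_zero Q.volume_ne_top]
  calc ∫⁻ x in Q.carrier, ‖f x - m'‖ₑ
      ≤ ∫⁻ x in Q.carrier, (‖f x - m n‖ₑ + ENNReal.ofReal |m n - m'|) := by
        refine lintegral_mono fun x => ?_
        rw [← Real.norm_eq_abs, ofReal_norm]
        calc ‖f x - m'‖ₑ = ‖(f x - m n) + (m n - m')‖ₑ := by congr 1; ring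
          _ ≤ _ := enorm_add_le _ _
    _ = (∫⁻ x in Q.carrier, ‖f x - m n‖ₑ) + ENNReal.ofReal |m n - m'| * volume Q.carrier := by
        rw [lintegral_add_right _ measurable_const, setLIntegral_const]
    _ ≤ _ := by
        gcongr
        exact (lintegral_mono_set (Q.carrier_subset_enlarge n)).trans hle'

/-! ### Comparison of the weak and the mean oscillation -/

theorem weakOscillation_le_oscillation (f : L0 d) (Q : Cube d) :
    weakOscillation f Q ≤ oscillation f Q := by
  refine (iInf_le _ (⨍ y in Q.carrier, f y)).trans ?_
  rw [oscillation, setLAverage_eq, ENNReal.div_eq_inv_mul]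
  gcongr
  refine iSup_le fun t => ?_
  have hmeas : Measurable fun x => ‖f x - ⨍ y in Q.carrier, f y‖ₑ :=
    ((AEEqFun.measurable f).sub measurable_const).enorm
  refine le_trans ?_ (mul_meas_ge_le_lintegral hmeas (t : ℝ≥0∞))
  rw [Measure.restrict_apply (measurableSet_le measurable_const hmeas)]
  gcongr
  rintro x ⟨hx, ht⟩
  refine ⟨?_, hx⟩
  simp only [mem_ofPred_eq]
  rw [← ofReal_norm, Real.norm_eq_abs, ← ENNReal.ofReal_coe_nnreal]
  exact ENNReal.ofReal_le_ofReal ht.le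

theorem weakSharpMaximal_le_sharpMaximal (f : L0 d) (x : Fin d → ℝ) :
    weakSharpMaximal f x ≤ sharpMaximal f x :=
  iSup_mono fun Q => indicator_le_indicator (weakOscillation_le_oscillation f Q)

theorem setLIntegral_le_mul_maximal (g : (Fin d → ℝ) → ℝ≥0∞) {Q : Cube d} {x : Fin d → ℝ}
    (hx : x ∈ Q.carrier) : ∫⁻ y in Q.carrier, g y ≤ volume Q.carrier * maximal g x := by
  have h := le_iSup_indicator (fun Q : Cube d => ⨍⁻ y in Q.carrier, g y ∂volume) hx
  rw [setLAverage_eq, ENNReal.div_le_iff_le_mul (Or.inl Q.volume_ne_zero)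
    (Or.inl Q.volume_ne_top)] at h
  rw [mul_comm]
  exact h

/-! ### Truncation -/

section Trunc

/-- The truncation of `f` at height `n`, cut off outside the ball of radius `n`. -/
def trunc (n : ℕ) (f : (Fin d → ℝ) → ℝ≥0∞) : (Fin d → ℝ) → ℝ≥0∞ :=
  (Metric.closedBall 0 n).indicator fun x => min (f x) n

theorem measurable_trunc (n : ℕ) {f : (Fin d → ℝ) → ℝ≥0∞} (hf : Measurable f) :
    Measurable (trunc n f) :=
  (hf.min measurable_const).indicator Metric.isClosed_closedBall.measurableSet

theorem trunc_le_self (n : ℕ) (f : (Fin d → ℝ) → ℝ≥0∞) (x : Fin d → ℝ) : trunc n f x ≤ f x :=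
  indicator_le_self' (fun _ _ => zero_le) x |>.trans (min_le_left _ _)

theorem trunc_le (n : ℕ) (f : (Fin d → ℝ) → ℝ≥0∞) (x : Fin d → ℝ) : trunc n f x ≤ n :=
  indicator_le_self' (fun _ _ => zero_le) x |>.trans (min_le_right _ _)

theorem trunc_ne_top (n : ℕ) (f : (Fin d → ℝ) → ℝ≥0∞) (x : Fin d → ℝ) : trunc n f x ≠ ∞ :=
  ((trunc_le n f x).trans_lt (ENNReal.natCast_lt_top n)).ne

theorem trunc_eq_zero {n : ℕ} {f : (Fin d → ℝ) → ℝ≥0∞} {x : Fin d → ℝ}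
    (hx : x ∉ Metric.closedBall 0 (n : ℝ)) : trunc n f x = 0 :=
  indicator_of_notMem hx _

theorem monotone_trunc (f : (Fin d → ℝ) → ℝ≥0∞) : Monotone fun n => trunc n f := by
  intro m n hmn x
  have hmn' : (m : ℝ≥0∞) ≤ n := by exact_mod_cast hmn
  have hsub : Metric.closedBall (0 : Fin d → ℝ) m ⊆ Metric.closedBall 0 n :=
    Metric.closedBall_subset_closedBall (by exact_mod_cast hmn)
  refine (indicator_le_indicator_of_subset hsub (fun _ => zero_le) x).trans ?_
  exact indicator_le_indicator (min_le_min le_rfl hmn')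

theorem tendsto_trunc (f : (Fin d → ℝ) → ℝ≥0∞) (x : Fin d → ℝ) :
    Tendsto (fun n => trunc n f x) atTop (𝓝 (f x)) := by
  have h1 : Tendsto (fun n : ℕ => min (f x) (n : ℝ≥0∞)) atTop (𝓝 (min (f x) ∞)) :=
    tendsto_const_nhds.min ENNReal.tendsto_nat_nhds_top
  rw [min_eq_left le_top] at h1
  refine h1.congr' ?_
  filter_upwards [tendsto_natCast_atTop_atTop.eventually (eventually_ge_atTop ‖x‖)] with n hn
  rw [trunc, indicator_of_mem (by simpa using hn)]

theorem memLp_trunc (n : ℕ) {f : (Fin d → ℝ) → ℝ≥0∞} (hf : Measurable f) :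
    MemLp (fun x => (trunc n f x).toReal) 2 (volume : Measure (Fin d → ℝ)) := by
  have hi : MemLp ((Metric.closedBall (0 : Fin d → ℝ) n).indicator fun _ => (n : ℝ)) 2 volume :=
    memLp_indicator_const 2 Metric.isClosed_closedBall.measurableSet _
      (Or.inr measure_closedBall_lt_top.ne)
  refine hi.mono (measurable_trunc n hf).ennreal_toReal.aestronglyMeasurable
    (Eventually.of_forall fun x => ?_)
  by_cases hx : x ∈ Metric.closedBall (0 : Fin d → ℝ) n
  · rw [indicator_of_mem hx, Real.norm_of_nonneg ENNReal.toReal_nonneg, Real.norm_natCast]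
    simpa using ENNReal.toReal_mono (ENNReal.natCast_ne_top n) (trunc_le n f x)
  · rw [trunc_eq_zero hx]; simp

theorem lintegral_mul_le_of_trunc {f g : (Fin d → ℝ) → ℝ≥0∞} (hf : Measurable f)
    (hg : Measurable g) {B : ℝ≥0∞} (h : ∀ n, ∫⁻ x, f x * trunc n g x ≤ B) :
    ∫⁻ x, f x * g x ≤ B := by
  have hm : ∫⁻ x, f x * g x = ⨆ n, ∫⁻ x, f x * trunc n g x := by
    rw [← lintegral_iSup (f := fun n x => f x * trunc n g x)
      (fun n => hf.mul (measurable_trunc n hg)) (fun m n hmn x => by exact mul_le_mul_right (monotone_trunc g hmn x) (f x))]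
    refine lintegral_congr fun x => ?_
    rw [← ENNReal.mul_iSup]
    congr 1
    exact tendsto_nhds_unique (tendsto_trunc g x)
      (tendsto_atTop_iSup fun m n hmn => monotone_trunc g hmn x)
  rw [hm]
  exact iSup_le h

end Trunc

/-! ### Function norms -/

namespace FunctionNorm

variable (X : FunctionNorm d)

theorem toFun_zero : X.toFun 0 = 0 := (X.eq_zero_iff 0 measurable_zero).2 (ae_eq_refl _)

theorem toFun_congr {f g : (Fin d → ℝ) → ℝ≥0∞} (hf : Measurable f) (hg : Measurable g)
    (h : f =ᵐ[volume] g) : X.toFun f = X.toFun g :=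
  le_antisymm (X.toFun_mono hf hg h.le) (X.toFun_mono hg hf h.symm.le)

/-- The infima over the tails of the sequence increase to the limit, so the Fatou property applies
to them. This is Fatou's lemma for the norm. -/
theorem toFun_le_of_tendsto {u : ℕ → (Fin d → ℝ) → ℝ≥0∞} {f : (Fin d → ℝ) → ℝ≥0∞}
    (hu : ∀ n, Measurable (u n)) (hf : Measurable f)
    (hlim : ∀ᵐ x ∂volume, Tendsto (fun n => u n x) atTop (𝓝 (f x))) {A : ℝ≥0∞}
    (hA : ∀ᶠ n in atTop, X.toFun (u n) ≤ A) : X.toFun f ≤ A := by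
  set v : ℕ → (Fin d → ℝ) → ℝ≥0∞ := fun n x => ⨅ i, u (i + n) x with hv
  have hvm : ∀ n, Measurable (v n) := fun n => Measurable.iInf fun i => hu (i + n)
  have hmono : ∀ x, Monotone fun n => v n x := by
    intro x
    refine monotone_nat_of_le_succ fun n => le_iInf fun i => ?_
    refine (iInf_le _ (i + 1)).trans_eq ?_
    rw [add_right_comm, add_assoc]
  rw [X.fatou v f hvm hf (Eventually.of_forall hmono) ?_]
  · obtain ⟨N, hN⟩ := eventually_atTop.1 hA
    refine iSup_le fun n => ?_
    refine le_trans (X.toFun_mono (hvm n) (hu (N + n)) (Eventually.of_forall fun x => ?_))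
      (hN (N + n) (Nat.le_add_right _ _))
    exact iInf_le _ N
  · filter_upwards [hlim] with x hx
    have := tendsto_atTop_iSup (hmono x)
    rwa [show ⨆ n, v n x = f x by
      rw [← hx.liminf_eq, liminf_eq_iSup_iInf_of_nat']] at this

theorem toFun_sum_le {ι : Type*} (s : Finset ι) {u : ι → (Fin d → ℝ) → ℝ≥0∞}
    (hu : ∀ i, Measurable (u i)) :
    X.toFun (fun x => ∑ i ∈ s, u i x) ≤ ∑ i ∈ s, X.toFun (u i) := by
  classical
  induction s using Finset.induction_on with
  | empty =>
    simp only [Finset.sum_empty]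
    exact X.toFun_zero.le
  | insert i s hi ih =>
    simp only [Finset.sum_insert hi]
    exact (X.add_le (u i) (fun x => ∑ i ∈ s, u i x) (hu i)
      (Finset.measurable_fun_sum s fun i _ => hu i)).trans (by gcongr)

theorem toFun_tsum_le {u : ℕ → (Fin d → ℝ) → ℝ≥0∞} (hu : ∀ i, Measurable (u i)) :
    X.toFun (fun x => ∑' i, u i x) ≤ ∑' i, X.toFun (u i) := by
  refine X.toFun_le_of_tendsto (u := fun n x => ∑ i ∈ Finset.range n, u i x)
    (fun n => Finset.measurable_fun_sum _ fun i _ => hu i) (Measurable.tsum hu)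
    (Eventually.of_forall fun x => ENNReal.tendsto_nat_tsum _) (Eventually.of_forall fun n => ?_)
  exact (X.toFun_sum_le _ hu).trans (ENNReal.sum_le_tsum _)

/-- The indicator of `{f = ∞}` multiplied by any `n` is still below `f`, so its norm must vanish. -/
theorem ae_lt_top {f : (Fin d → ℝ) → ℝ≥0∞} (hf : Measurable f) (h : X.toFun f < ∞) :
    ∀ᵐ x ∂volume, f x < ∞ := by
  set e : (Fin d → ℝ) → ℝ≥0∞ := {x | f x = ∞}.indicator 1 with he
  have hE : MeasurableSet {x | f x = ∞} := hf (measurableSet_singleton ∞)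
  have hem : Measurable e := measurable_one.indicator hE
  have hle : ∀ n : ℕ, n * X.toFun e ≤ X.toFun f := by
    intro n
    have := X.smul_eq (n : ℝ≥0) e hem
    rw [ENNReal.coe_natCast] at this
    rw [← this]
    refine X.toFun_mono (hem.const_mul _) hf (Eventually.of_forall fun x => ?_)
    by_cases hx : f x = ∞
    · simp [hx]
    · rw [he, indicator_of_notMem (by exact hx)]; simp
  have h0 : X.toFun e = 0 := by
    by_contra hne
    have hlim : Tendsto (fun n : ℕ => (n : ℝ≥0∞) * X.toFun e) atTop (𝓝 (∞ * X.toFun e)) :=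
      ENNReal.Tendsto.mul_const ENNReal.tendsto_nat_nhds_top (Or.inl ENNReal.top_ne_zero)
    rw [ENNReal.top_mul hne] at hlim
    exact absurd (top_le_iff.1 (le_of_tendsto' hlim hle)) h.ne
  filter_upwards [(X.eq_zero_iff e hem).1 h0] with x hx
  rw [lt_top_iff_ne_top]
  intro hx'
  rw [he, indicator_of_mem (by exact hx')] at hx
  simp at hx

/-! ### Hölder's inequality and the Lorentz-Luxemburg theorem -/

theorem lintegral_mul_le_dual {f : (Fin d → ℝ) → ℝ≥0∞} (hf : Measurable f)
    (h : X.toFun f < ∞) (g : (Fin d → ℝ) → ℝ≥0∞) :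
    ∫⁻ x, f x * g x ≤ X.toFun f * X.dual g := by
  by_cases h0 : X.toFun f = 0
  · have : ∫⁻ x, f x * g x = ∫⁻ _ : Fin d → ℝ, 0 := by
      refine lintegral_congr_ae ?_
      filter_upwards [(X.eq_zero_iff f hf).1 h0] with x hx
      simp [hx]
    simp [this]
  set a : ℝ≥0 := (X.toFun f).toNNReal with ha
  have haf : (a : ℝ≥0∞) = X.toFun f := ENNReal.coe_toNNReal h.ne
  have ha0 : a ≠ 0 := by
    intro h'
    rw [h', ENNReal.coe_zero] at haf
    exact h0 haf.symm
  have ha' : (a : ℝ≥0∞) ≠ 0 := by exact_mod_cast ha0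
  have h1 : X.toFun (fun x => ((a⁻¹ : ℝ≥0) : ℝ≥0∞) * f x) = 1 := by
    rw [X.smul_eq _ f hf, ← haf, ENNReal.coe_inv ha0, ENNReal.inv_mul_cancel ha' ENNReal.coe_ne_top]
  have h2 : ∫⁻ x, (((a⁻¹ : ℝ≥0) : ℝ≥0∞) * f x) * g x ≤ X.dual g :=
    le_iSup₂_of_le (fun x => ((a⁻¹ : ℝ≥0) : ℝ≥0∞) * f x) (hf.const_mul _)
      (le_iSup_of_le h1 le_rfl)
  simp_rw [mul_assoc] at h2
  rw [lintegral_const_mul' _ _ ENNReal.coe_ne_top, ENNReal.coe_inv ha0] at h2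
  rw [← haf]
  rwa [ENNReal.inv_mul_le_iff ha' ENNReal.coe_ne_top] at h2

theorem dual_mono {g g' : (Fin d → ℝ) → ℝ≥0∞} (h : ∀ x, g x ≤ g' x) : X.dual g ≤ X.dual g' :=
  iSup_mono fun _ => iSup₂_mono fun _ _ => lintegral_mono fun x => mul_le_mul_right (h x) _

/-- The closed ball of radius `A` of `X`, viewed inside `L²`. -/
def ballL2 (A : ℝ≥0∞) : Set (Lp ℝ 2 (volume : Measure (Fin d → ℝ))) :=
  {h | X.toFun (fun x => ‖h x‖ₑ) ≤ A}

theorem measurable_enorm_Lp (h : Lp ℝ 2 (volume : Measure (Fin d → ℝ))) :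
    Measurable fun x => ‖h x‖ₑ :=
  (Lp.stronglyMeasurable h).measurable.enorm

theorem convex_ballL2 (A : ℝ≥0∞) : Convex ℝ (X.ballL2 A) := by
  intro h hh k hk a b ha hb hab
  have hm := measurable_enorm_Lp (d := d)
  have hle : X.toFun (fun x => ‖(a • h + b • k : Lp ℝ 2 volume) x‖ₑ)
      ≤ X.toFun ((fun x => ((a.toNNReal : ℝ≥0) : ℝ≥0∞) * ‖h x‖ₑ)
        + fun x => ((b.toNNReal : ℝ≥0) : ℝ≥0∞) * ‖k x‖ₑ) := by
    refine X.toFun_mono (hm _) (((hm h).const_mul _).add ((hm k).const_mul _)) ?_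
    filter_upwards [Lp.coeFn_add (a • h) (b • k), Lp.coeFn_smul a h, Lp.coeFn_smul b k]
      with x h1 h2 h3
    rw [h1, Pi.add_apply, h2, h3, Pi.smul_apply, Pi.smul_apply, Pi.add_apply]
    refine (enorm_add_le _ _).trans (add_le_add ?_ ?_)
    · rw [smul_eq_mul, enorm_mul, Real.enorm_of_nonneg ha]; exact le_rfl
    · rw [smul_eq_mul, enorm_mul, Real.enorm_of_nonneg hb]; exact le_rfl
  refine hle.trans ((X.add_le _ _ ((hm h).const_mul _) ((hm k).const_mul _)).trans ?_)
  rw [X.smul_eq _ _ (hm h), X.smul_eq _ _ (hm k)]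
  calc (a.toNNReal : ℝ≥0∞) * X.toFun (fun x => ‖h x‖ₑ)
        + (b.toNNReal : ℝ≥0∞) * X.toFun (fun x => ‖k x‖ₑ)
      ≤ (a.toNNReal : ℝ≥0∞) * A + (b.toNNReal : ℝ≥0∞) * A := by
        gcongr
        · exact hh
        · exact hk
    _ = A := by
        rw [← add_mul, ← ENNReal.coe_add, ← Real.toNNReal_add ha hb, hab]
        simp

theorem isClosed_ballL2 (A : ℝ≥0∞) : IsClosed (X.ballL2 A) := by
  refine IsSeqClosed.isClosed fun u h hu hlim => ?_
  obtain ⟨ns, -, hns⟩ := (tendstoInMeasure_of_tendsto_Lp hlim).exists_seq_tendsto_ae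
  refine X.toFun_le_of_tendsto (u := fun n x => ‖u (ns n) x‖ₑ)
    (fun n => measurable_enorm_Lp _) (measurable_enorm_Lp _) ?_ (Eventually.of_forall fun n => hu _)
  filter_upwards [hns] with x hx
  exact hx.enorm

/-- Separation in the Hilbert space `L²`: the ball of `X` is convex and closed there (the latter by
Fatou), and if `p` is its point nearest to `F`, then `G = F - p` satisfies `⟨G, k⟩ ≤ ⟨G, p⟩` on the
ball and `⟨G, F⟩ = ⟨G, p⟩ + ‖G‖²`. The functional is `g = |G|` and the constant is `⟨G, p⟩`. -/
theorem exists_separating {f : (Fin d → ℝ) → ℝ≥0∞} (hf : Measurable f) (hfin : ∀ x, f x ≠ ∞)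
    (hL2 : MemLp (fun x => (f x).toReal) 2 (volume : Measure (Fin d → ℝ))) {A : ℝ≥0∞}
    (hA : A < X.toFun f) :
    ∃ (g : (Fin d → ℝ) → ℝ≥0∞) (c : ℝ), Measurable g ∧
      (∀ h ∈ X.ballL2 A, ∫⁻ x, ‖h x‖ₑ * g x ≤ ENNReal.ofReal c) ∧
      ENNReal.ofReal c < ∫⁻ x, f x * g x := by
  set F : Lp ℝ 2 (volume : Measure (Fin d → ℝ)) := hL2.toLp with hF
  have hFf : ∀ᵐ x ∂volume, ‖F x‖ₑ = f x := by
    filter_upwards [hL2.coeFn_toLp] with x hx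
    rw [hF, hx, Real.enorm_toReal (hfin x)]
  have hzero : (0 : Lp ℝ 2 (volume : Measure (Fin d → ℝ))) ∈ X.ballL2 A := by
    have : X.toFun (fun x => ‖(0 : Lp ℝ 2 (volume : Measure (Fin d → ℝ))) x‖ₑ) = 0 := by
      refine (X.eq_zero_iff _ (measurable_enorm_Lp _)).2 ?_
      filter_upwards [Lp.coeFn_zero ℝ 2 (volume : Measure (Fin d → ℝ))] with x hx
      simp
    exact this.le.trans zero_le
  obtain ⟨p, hp, hmin⟩ := exists_norm_eq_iInf_of_complete_convex ⟨0, hzero⟩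
    (X.isClosed_ballL2 A).isComplete (X.convex_ballL2 A) F
  have hproj := (norm_eq_iInf_iff_real_inner_le_zero (X.convex_ballL2 A) hp).1 hmin
  set G := F - p with hG
  have hG0 : G ≠ 0 := by
    intro h
    rw [hG, sub_eq_zero] at h
    rw [← h] at hp
    refine absurd (le_trans (X.toFun_congr hf (measurable_enorm_Lp _) ?_).le hp) (not_le.2 hA)
    filter_upwards [hFf] with x hx using hx.symm
  have hGm : Measurable G := (Lp.stronglyMeasurable G).measurable
  refine ⟨fun x => ‖G x‖ₑ, inner ℝ G p, measurable_enorm_Lp G, fun h hh => ?_, ?_⟩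
  · have hhm : Measurable h := (Lp.stronglyMeasurable h).measurable
    -- The ball depends on absolute values only, so the sign of `h` can be matched to that of `G`;
    -- this turns the inner product into `∫ |h| |G|`.
    have hk : MemLp (fun x => if 0 ≤ G x then |h x| else -|h x|) 2
        (volume : Measure (Fin d → ℝ)) := by
      refine (Lp.memLp h).mono (Measurable.aestronglyMeasurable ?_)
        (Eventually.of_forall fun x => ?_)
      · exact Measurable.ite (measurableSet_le measurable_const hGm) hhm.abs hhm.abs.neg
      · split_ifs <;> simp
    set k : Lp ℝ 2 (volume : Measure (Fin d → ℝ)) := hk.toLp with hkdef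
    have hkx := hk.coeFn_toLp
    have hkmem : k ∈ X.ballL2 A := by
      refine (X.toFun_congr (measurable_enorm_Lp k) (measurable_enorm_Lp h) ?_).le.trans hh
      filter_upwards [hkx] with x hx
      rw [hkdef, hx]
      split_ifs <;> simp
    have hle : inner ℝ G k ≤ inner ℝ G p := by
      have := hproj k hkmem
      rw [inner_sub_right] at this
      linarith
    refine le_trans (le_of_eq ?_) (ENNReal.ofReal_le_ofReal hle)
    have hprod : (fun x => inner ℝ (G x) (k x)) =ᵐ[volume] fun x => |h x| * |G x| := by
      filter_upwards [hkx] with x hx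
      rw [hkdef, hx]
      by_cases h0 : 0 ≤ G x
      · simp [h0, abs_of_nonneg h0]
      · simp [h0, abs_of_neg (not_le.1 h0)]
    rw [L2.inner_def, integral_congr_ae hprod, ofReal_integral_eq_lintegral_ofReal
      ((L2.integrable_inner (𝕜 := ℝ) G k).congr hprod)
      (Eventually.of_forall fun x => mul_nonneg (abs_nonneg _) (abs_nonneg _))]
    refine lintegral_congr fun x => ?_
    rw [ENNReal.ofReal_mul (abs_nonneg _), ← Real.norm_eq_abs, ← Real.norm_eq_abs, ofReal_norm,
      ofReal_norm]
  · have hlt : inner ℝ G p < inner ℝ G F := by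
      have h1 : inner ℝ G F - inner ℝ G p = inner ℝ G G := by rw [← inner_sub_right]
      have h2 : 0 < inner ℝ G G := by
        rw [real_inner_self_eq_norm_sq]
        have := norm_pos_iff.2 hG0
        positivity
      linarith
    have hnn : 0 ≤ inner ℝ G p := by
      have := hproj 0 hzero
      rw [inner_sub_right, inner_zero_right] at this
      linarith
    refine lt_of_lt_of_le ((ENNReal.ofReal_lt_ofReal_iff (hnn.trans_lt hlt)).2 hlt) ?_
    rw [L2.inner_def]
    refine (Real.ofReal_le_enorm _).trans ((enorm_integral_le_lintegral_enorm _).trans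
      (lintegral_mono_ae ?_))
    filter_upwards [hFf] with x hx
    rw [← hx]
    simp [enorm_mul]

/-- The Lorentz-Luxemburg theorem `X'' = X`, tested on bounded functions with bounded support. -/
theorem toFun_le_of_lintegral_mul_le {f : (Fin d → ℝ) → ℝ≥0∞} (hf : Measurable f) {A : ℝ≥0∞}
    (h : ∀ (g : (Fin d → ℝ) → ℝ≥0∞) (n : ℕ), Measurable g → (∀ x, g x ≤ n) →
      (∀ x ∉ Metric.closedBall (0 : Fin d → ℝ) n, g x = 0) → X.dual g < ∞ →
      ∫⁻ x, f x * g x ≤ A * X.dual g) : X.toFun f ≤ A := by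
  refine X.toFun_le_of_tendsto (fun n => measurable_trunc n hf) hf
    (Eventually.of_forall fun x => tendsto_trunc f x) (Eventually.of_forall fun m => ?_)
  by_contra! hlt
  -- Separation is from the ball of radius `B` rather than `A`: unlike `A`, which may be `0`, `B`
  -- can be divided by. Rescaling the ball gives `‖g‖_{X'} ≤ c / B`, and then `A ‖g‖_{X'} ≤ c`
  -- contradicts the separation.
  obtain ⟨B, hAB, hB⟩ := ENNReal.lt_iff_exists_nnreal_btwn.1 hlt
  have hB0 : (B : ℝ≥0∞) ≠ 0 := (zero_le.trans_lt hAB).ne'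
  obtain ⟨g, c, hg, hgc, hcg⟩ := X.exists_separating (measurable_trunc m hf) (trunc_ne_top m f)
    (memLp_trunc m hf) hB
  have hdual : X.dual g ≤ ENNReal.ofReal c / B := by
    refine iSup_le fun k => iSup₂_le fun hk hk1 => ?_
    rw [lintegral_congr fun y => mul_comm (k y) (g y)]
    refine lintegral_mul_le_of_trunc hg hk fun n => ?_
    rw [ENNReal.le_div_iff_mul_le (Or.inl hB0) (Or.inl ENNReal.coe_ne_top), mul_comm,
      ← lintegral_const_mul' _ _ ENNReal.coe_ne_top]
    have hmem : MemLp (fun x => (B : ℝ) * (trunc n k x).toReal) 2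
        (volume : Measure (Fin d → ℝ)) := (memLp_trunc n hk).const_mul _
    have hx : ∀ᵐ x ∂volume, ‖hmem.toLp _ x‖ₑ = B * trunc n k x := by
      filter_upwards [hmem.coeFn_toLp] with x hx
      rw [hx, enorm_mul, Real.enorm_toReal (trunc_ne_top n k x)]
      congr 1
      simp
    refine le_trans (lintegral_mono_ae ?_) (hgc (hmem.toLp _) ?_)
    · filter_upwards [hx] with x hx
      rw [hx, mul_assoc, mul_comm (g x)]
    · change X.toFun _ ≤ _
      rw [X.toFun_congr (measurable_enorm_Lp _) ((measurable_trunc n hk).const_mul _) hx,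
        X.smul_eq _ _ (measurable_trunc n hk)]
      calc (B : ℝ≥0∞) * X.toFun (trunc n k) ≤ B * X.toFun k := by
            gcongr
            exact X.toFun_mono (measurable_trunc n hk) hk
              (Eventually.of_forall fun x => trunc_le_self n k x)
        _ = B := by rw [hk1, mul_one]
  have hfin : X.dual g < ∞ := hdual.trans_lt (ENNReal.div_lt_top ENNReal.ofReal_ne_top hB0)
  refine absurd hcg (not_lt.2 ?_)
  calc ∫⁻ x, trunc m f x * g x ≤ ∫⁻ x, f x * g x :=
        lintegral_mono fun x => mul_le_mul_left (trunc_le_self m f x) _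
    _ ≤ A * X.dual g := by
        refine lintegral_mul_le_of_trunc hf hg fun n => ?_
        have hmono := X.dual_mono (trunc_le_self n g)
        exact (h (trunc n g) n (measurable_trunc n hg) (trunc_le n g)
          (fun x hx => trunc_eq_zero hx) (hmono.trans_lt hfin)).trans (by gcongr)
    _ ≤ B * (ENNReal.ofReal c / B) := by gcongr
    _ = ENNReal.ofReal c := ENNReal.mul_div_cancel hB0 ENNReal.coe_ne_top

end FunctionNorm

/-- The infimum defining the operator norm of the maximal operator is attained. -/
theorem apply_maximal_le {ρ : ((Fin d → ℝ) → ℝ≥0∞) → ℝ≥0∞} (hρ : maximalOpNorm ρ < ∞)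
    {f : (Fin d → ℝ) → ℝ≥0∞} (hf : Measurable f) (h : ρ f < ∞) :
    ρ (maximal f) ≤ maximalOpNorm ρ * ρ f := by
  by_cases h0 : ρ f = 0
  · obtain ⟨C, hC, -⟩ := sInf_lt_iff.1 hρ
    have := hC f hf h
    simpa [h0] using this
  rw [← ENNReal.div_le_iff_le_mul (Or.inl h0) (Or.inl h.ne)]
  refine le_sInf fun C hC => ?_
  rw [ENNReal.div_le_iff_le_mul (Or.inl h0) (Or.inl h.ne)]
  exact hC f hf h

/-! ### Dyadic subcubes and the Calderón-Zygmund decomposition -/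

namespace Cube

theorem carrier_subset_closedBall (Q : Cube d) :
    Q.carrier ⊆ Metric.closedBall (fun i => Q.corner i + Q.side / 2) (Q.side / 2) := by
  intro x hx
  rw [mem_carrier] at hx
  rw [closedBall_pi _ (by linarith [Q.side_pos])]
  intro i _
  change x i ∈ Metric.closedBall _ _
  rw [Real.closedBall_eq_Icc]
  exact ⟨by linarith [(hx i).1], by linarith [(hx i).2]⟩

/-- The cube with index `k` in the `n`-th generation of the dyadic grid generated by `Q`. -/
def dyadic (Q : Cube d) (n : ℕ) (k : Fin d → ℤ) : Cube d where
  corner i := Q.corner i + Q.side / 2 ^ n * k i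
  side := Q.side / 2 ^ n
  side_pos := div_pos Q.side_pos (by positivity)

/-- The index of the cube of the `n`-th generation containing `x`. -/
def index (Q : Cube d) (n : ℕ) (x : Fin d → ℝ) (i : Fin d) : ℤ :=
  ⌊(x i - Q.corner i) / (Q.side / 2 ^ n)⌋

theorem mem_dyadic {Q : Cube d} {n : ℕ} {k : Fin d → ℤ} {x : Fin d → ℝ} :
    x ∈ (Q.dyadic n k).carrier ↔ Q.index n x = k := by
  rw [mem_carrier, funext_iff]
  refine forall_congr' fun i => ?_
  have hs : 0 < Q.side / 2 ^ n := div_pos Q.side_pos (by positivity)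
  rw [index, Int.floor_eq_iff, le_div_iff₀ hs, div_lt_iff₀ hs]
  simp only [dyadic]
  constructor
  · rintro ⟨h1, h2⟩
    constructor <;> nlinarith
  · rintro ⟨h1, h2⟩
    constructor <;> nlinarith

theorem dyadic_zero (Q : Cube d) : (Q.dyadic 0 0).carrier = Q.carrier := by
  ext x; simp [mem_carrier, dyadic]

theorem index_of_succ {Q : Cube d} {n : ℕ} {x y : Fin d → ℝ}
    (h : Q.index (n + 1) x = Q.index (n + 1) y) : Q.index n x = Q.index n y := by
  have key : ∀ z : Fin d → ℝ, ∀ i, Q.index n z i = Q.index (n + 1) z i / 2 := by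
    intro z i
    have : (z i - Q.corner i) / (Q.side / 2 ^ n)
        = (z i - Q.corner i) / (Q.side / 2 ^ (n + 1)) / (2 : ℕ) := by
      have := Q.side_pos
      push_cast
      field_simp
      ring
    rw [index, this, Int.floor_div_natCast]
    rfl
  funext i
  rw [key, key, h]

theorem index_of_le {Q : Cube d} {m n : ℕ} (hmn : m ≤ n) {x y : Fin d → ℝ}
    (h : Q.index n x = Q.index n y) : Q.index m x = Q.index m y := by
  induction n, hmn using Nat.le_induction with
  | base => exact h
  | succ n _ ih => exact ih (index_of_succ h)

theorem volume_dyadic_succ (Q : Cube d) (n : ℕ) (k l : Fin d → ℤ) :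
    volume (Q.dyadic n k).carrier = 2 ^ d * volume (Q.dyadic (n + 1) l).carrier := by
  rw [volume_carrier, volume_carrier, ← mul_pow]
  congr 1
  simp only [dyadic]
  rw [show (2 : ℝ≥0∞) = ENNReal.ofReal 2 by simp, ← ENNReal.ofReal_mul zero_le_two]
  congr 1
  field_simp
  ring

end Cube

/-- This is the Lebesgue density theorem: balls of the sup metric are cubes up to null sets, and
they need only contain `x`, not be centred at it. -/
theorem ae_exists_dyadic_density (Q : Cube d) {E : Set (Fin d → ℝ)} (hE : MeasurableSet E)
    {θ : ℝ≥0∞} (hθ : θ < 1) :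
    ∀ᵐ x ∂volume, x ∈ E → ∃ n, θ * volume (Q.dyadic n (Q.index n x)).carrier
      < volume (E ∩ (Q.dyadic n (Q.index n x)).carrier) := by
  have h := IsUnifLocDoublingMeasure.ae_tendsto_measure_inter_div
    (volume : Measure (Fin d → ℝ)) E 1
  rw [ae_restrict_iff' hE] at h
  filter_upwards [h] with x hx hxE
  set P : ℕ → Cube d := fun n => Q.dyadic n (Q.index n x) with hP
  have hlim : Tendsto (fun n => (P n).side / 2) atTop (𝓝[>] 0) := by
    refine tendsto_nhdsWithin_iff.2 ⟨?_, Eventually.of_forall fun n => ?_⟩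
    · have h1 : Tendsto (fun n : ℕ => Q.side / 2 * (1 / 2 : ℝ) ^ n) atTop (𝓝 (Q.side / 2 * 0)) :=
        (tendsto_pow_atTop_nhds_zero_of_lt_one (by norm_num) (by norm_num)).const_mul _
      rw [mul_zero] at h1
      refine h1.congr fun n => ?_
      simp only [hP, Cube.dyadic, one_div, inv_pow]
      ring
    · exact half_pos (P n).side_pos
  have := hx hxE (fun n i => (P n).corner i + (P n).side / 2) (fun n => (P n).side / 2) hlim
    (Eventually.of_forall fun n => by
      rw [one_mul]
      exact (P n).carrier_subset_closedBall (Cube.mem_dyadic.2 rfl))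
  obtain ⟨n, hn⟩ := (this.eventually (lt_mem_nhds hθ)).exists
  refine ⟨n, ?_⟩
  rw [← measure_congr (P n).carrier_ae_eq_closedBall,
    ← measure_congr ((ae_eq_refl E).inter (P n).carrier_ae_eq_closedBall),
    ENNReal.lt_div_iff_mul_lt (Or.inl (P n).volume_ne_zero) (Or.inl (P n).volume_ne_top)] at hn
  exact hn

/-- The Calderón-Zygmund decomposition of a set which occupies a small part of a cube. -/
theorem calderonZygmund (Q : Cube d) {E : Set (Fin d → ℝ)} (hE : MeasurableSet E)
    (hEQ : E ⊆ Q.carrier) (hsmall : 2 ^ (d + 2) * volume E ≤ volume Q.carrier) :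
    ∃ (ι : Type) (_ : Countable ι) (P : ι → Cube d),
      Pairwise (Function.onFun Disjoint fun i => (P i).carrier) ∧
      (∀ i, (P i).carrier ⊆ Q.carrier) ∧
      2 * volume (⋃ i, (P i).carrier) ≤ volume Q.carrier ∧
      (∀ i, 2 * volume (E ∩ (P i).carrier) ≤ volume (P i).carrier) ∧
      volume (E \ ⋃ i, (P i).carrier) = 0 := by
  -- Cubes in which `E` has density above `2^-(d+1)`. A first bad cube has a good parent, which is
  -- `2^d` times larger, so its own density is at most `1/2`. Disjoint bad cubes have total measure
  -- at most `2^(d+1) |E| ≤ |Q| / 2`.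
  set bad : ℕ → (Fin d → ℤ) → Prop := fun n k =>
    volume (Q.dyadic n k).carrier < 2 ^ (d + 1) * volume (E ∩ (Q.dyadic n k).carrier) with hbad
  -- One witness `x` suffices to test all ancestors, since the points of a dyadic cube share them.
  -- Cubes of the grid outside `Q` need no exclusion: a bad cube meets `E ⊆ Q`.
  set J : Set (ℕ × (Fin d → ℤ)) := {p | bad p.1 p.2 ∧
    ∃ x ∈ (Q.dyadic p.1 p.2).carrier, ∀ m < p.1, ¬ bad m (Q.index m x)} with hJ
  set P : J → Cube d := fun p => Q.dyadic p.1.1 p.1.2 with hP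
  have hdisj : Pairwise (Function.onFun Disjoint fun i => (P i).carrier) := by
    rintro ⟨⟨n, k⟩, hk, x, hx, hxn⟩ ⟨⟨m, l⟩, hl, z, hz, hzm⟩ hne
    refine Set.disjoint_left.2 fun y hy hy' => hne ?_
    simp only [hP, Cube.mem_dyadic] at hy hy' hx hz hxn hzm hk hl
    rcases lt_trichotomy m n with h | h | h
    · refine absurd ?_ (hxn m h)
      rw [Cube.index_of_le h.le (hx.trans hy.symm), hy']
      exact hl
    · subst h
      simp [← hy, ← hy']
    · refine absurd ?_ (hzm n h)
      rw [Cube.index_of_le h.le (hz.trans hy'.symm), hy]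
      exact hk
  have hpow : (2 : ℝ≥0∞) ^ (d + 1) ≠ 0 := by positivity
  have hpow' : (2 : ℝ≥0∞) ^ (d + 1) ≠ ∞ := ENNReal.pow_ne_top (by simp)
  have hUm : ∀ i, MeasurableSet (P i).carrier := fun i => (P i).measurableSet_carrier
  refine ⟨J, inferInstance, P, hdisj, ?_, ?_, ?_, ?_⟩
  · rintro ⟨⟨n, k⟩, hk, _⟩ z hz
    have hne : (E ∩ (Q.dyadic n k).carrier).Nonempty := by
      by_contra hempty
      rw [not_nonempty_iff_eq_empty] at hempty
      simp [hbad, hempty] at hk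
    obtain ⟨y, hyE, hy⟩ := hne
    have hyQ := hEQ hyE
    rw [← Q.dyadic_zero, Cube.mem_dyadic] at hyQ ⊢
    have hz' : Q.index n z = k := Cube.mem_dyadic.1 hz
    have hy' : Q.index n y = k := Cube.mem_dyadic.1 hy
    rw [← hyQ]
    exact Cube.index_of_le (Nat.zero_le n) (hz'.trans hy'.symm)
  · have h1 : volume (⋃ i, (P i).carrier) ≤ 2 ^ (d + 1) * volume E := by
      calc volume (⋃ i, (P i).carrier) ≤ ∑' i, volume (P i).carrier := measure_iUnion_le _
        _ ≤ ∑' i, 2 ^ (d + 1) * volume (E ∩ (P i).carrier) :=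
            ENNReal.tsum_le_tsum fun i => i.2.1.le
        _ = 2 ^ (d + 1) * volume (⋃ i, E ∩ (P i).carrier) := by
            rw [ENNReal.tsum_mul_left, measure_iUnion
              (fun i j hij => (hdisj hij).mono inter_subset_right inter_subset_right)
              (fun i => hE.inter (hUm i))]
        _ ≤ 2 ^ (d + 1) * volume E := by
            gcongr
            exact iUnion_subset fun i => inter_subset_left
    calc 2 * volume (⋃ i, (P i).carrier) ≤ 2 * (2 ^ (d + 1) * volume E) := by gcongr
      _ = 2 ^ (d + 2) * volume E := by ring
      _ ≤ _ := hsmall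
  · rintro ⟨⟨n, k⟩, hk, x, hx, hxn⟩
    simp only at hk hx hxn
    -- A cube of generation `0` has no parent in the grid, but `hsmall` prevents it from being bad.
    cases n with
    | zero =>
      refine absurd hk (not_lt.2 ?_)
      have hvol : volume (Q.dyadic 0 k).carrier = volume Q.carrier := by
        rw [Cube.volume_carrier, Cube.volume_carrier]; simp [Cube.dyadic]
      rw [hvol]
      refine le_trans ?_ hsmall
      gcongr
      · exact one_le_two
      · exact Nat.le_succ _
      · exact inter_subset_left
    | succ m =>
      have hm := not_lt.1 (hxn m (Nat.lt_succ_self m))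
      have hsub : (Q.dyadic (m + 1) k).carrier ⊆ (Q.dyadic m (Q.index m x)).carrier := by
        intro z hz
        rw [Cube.mem_dyadic] at hz hx ⊢
        exact Cube.index_of_succ (hz.trans hx.symm)
      rw [Q.volume_dyadic_succ m _ k] at hm
      have h2 : (2 : ℝ≥0∞) ^ d * (2 * volume (E ∩ (Q.dyadic (m + 1) k).carrier))
          ≤ 2 ^ d * volume (Q.dyadic (m + 1) k).carrier := by
        rw [← mul_assoc, ← pow_succ]
        refine le_trans ?_ hm
        gcongr
      exact (ENNReal.mul_le_mul_iff_right (by positivity) (ENNReal.pow_ne_top (by simp))).1 h2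
  · have hθ : ((2 : ℝ≥0∞) ^ (d + 1))⁻¹ < 1 := by
      rw [ENNReal.inv_lt_one]
      exact ENNReal.one_lt_two.trans_le (le_self_pow₀ ENNReal.one_lt_two.le (Nat.succ_ne_zero d))
    rw [measure_eq_zero_iff_ae_notMem]
    filter_upwards [ae_exists_dyadic_density Q hE hθ] with x hx hxE
    have hex : ∃ n, bad n (Q.index n x) := by
      obtain ⟨n, hn⟩ := hx hxE.1
      refine ⟨n, ?_⟩
      rwa [← ENNReal.div_eq_inv_mul, ENNReal.div_lt_iff (Or.inl hpow) (Or.inl hpow'),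
        mul_comm] at hn
    classical
    refine hxE.2 (mem_iUnion.2 ⟨⟨(Nat.find hex, Q.index (Nat.find hex) x), Nat.find_spec hex, x,
      Cube.mem_dyadic.2 rfl, fun m hm => Nat.find_min hex hm⟩, Cube.mem_dyadic.2 rfl⟩)

/-! ### The sharp maximal function inequality on cubes -/

section Core

variable {f : (Fin d → ℝ) → ℝ} {g H : (Fin d → ℝ) → ℝ≥0∞} {b : Cube d → ℝ≥0} {c : Cube d → ℝ}

/-- The quantity which is estimated by iterating the Calderón-Zygmund decomposition. -/
def oscPairing (f : (Fin d → ℝ) → ℝ) (g : (Fin d → ℝ) → ℝ≥0∞) (b : Cube d → ℝ≥0) (c : Cube d → ℝ)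
    (Q : Cube d) : ℝ≥0∞ :=
  b Q * (∫⁻ x in Q.carrier, g x) + ∫⁻ x in Q.carrier, ‖f x - c Q‖ₑ * g x

/-- Decompose the exceptional set where `|f - c Q| > b Q`. Off the selected cubes `|f - c Q| ≤ b Q`
almost everywhere; on a selected cube `P`, `|f - c Q| ≤ |f - c P| + b Q + b P`. The term `b P ∫_P g`
is absorbed by the first summand of `oscPairing` for `P`, which is there for this purpose. What is
left is `2 b Q ∫_Q g`, and it is at most `4 ∫ H` over the unselected part, since that part fills at
least half of `Q`. -/
theorem oscPairing_step (hf : Measurable f) (hg : Measurable g)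
    (hosc : ∀ Q : Cube d, 2 ^ (d + 2) * volume {x | x ∈ Q.carrier ∧ (b Q : ℝ) < |f x - c Q|}
      ≤ volume Q.carrier)
    (hH : ∀ Q : Cube d, ∀ x ∈ Q.carrier, b Q * (∫⁻ y in Q.carrier, g y) ≤ volume Q.carrier * H x)
    (Q : Cube d) :
    ∃ (ι : Type) (_ : Countable ι) (P : ι → Cube d),
      Pairwise (Function.onFun Disjoint fun i => (P i).carrier) ∧
      (∀ i, (P i).carrier ⊆ Q.carrier) ∧
      2 * volume (⋃ i, (P i).carrier) ≤ volume Q.carrier ∧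
      oscPairing f g b c Q ≤ 4 * (∫⁻ x in Q.carrier \ ⋃ i, (P i).carrier, H x)
        + ∑' i, oscPairing f g b c (P i) := by
  set E : Cube d → Set (Fin d → ℝ) := fun Q => {x | x ∈ Q.carrier ∧ (b Q : ℝ) < |f x - c Q|} with hE
  have hEm : ∀ Q, MeasurableSet (E Q) := fun Q =>
    Q.measurableSet_carrier.inter (measurableSet_lt measurable_const (hf.sub_const _).abs)
  obtain ⟨ι, hι, P, hdisj, hPQ, hvol, hhalf, hnull⟩ :=
    calderonZygmund Q (hEm Q) (fun x hx => hx.1) (hosc Q)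
  refine ⟨ι, hι, P, hdisj, hPQ, hvol, ?_⟩
  set U := ⋃ i, (P i).carrier with hU
  have hUm : MeasurableSet U := MeasurableSet.iUnion fun i => (P i).measurableSet_carrier
  have hUQ : U ⊆ Q.carrier := iUnion_subset hPQ
  have hsplit : ∀ u : (Fin d → ℝ) → ℝ≥0∞,
      ∫⁻ x in Q.carrier, u x = (∫⁻ x in U, u x) + ∫⁻ x in Q.carrier \ U, u x := by
    intro u
    rw [← lintegral_inter_add_sdiff u Q.carrier hUm, inter_eq_self_of_subset_right hUQ]
  have hsum : ∀ u : (Fin d → ℝ) → ℝ≥0∞,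
      ∫⁻ x in U, u x = ∑' i, ∫⁻ x in (P i).carrier, u x := fun u =>
    lintegral_iUnion (fun i => (P i).measurableSet_carrier) hdisj u
  have hmain : b Q * (∫⁻ x in Q.carrier, g x) ≤ 2 * ∫⁻ x in Q.carrier \ U, H x := by
    have hVle : volume Q.carrier ≤ 2 * volume (Q.carrier \ U) := by
      have h1 : volume U + volume (Q.carrier \ U) = volume Q.carrier := by
        rw [← measure_inter_add_sdiff Q.carrier hUm, inter_eq_self_of_subset_right hUQ]
      have h2 : volume U ≤ volume (Q.carrier \ U) := by
        rw [← h1, two_mul] at hvol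
        exact (ENNReal.add_le_add_iff_left
          ((measure_mono hUQ).trans_lt Q.volume_lt_top).ne).1 hvol
      rw [← h1, two_mul]
      gcongr
    set m := b Q * (∫⁻ x in Q.carrier, g x) / volume Q.carrier with hm
    calc b Q * (∫⁻ x in Q.carrier, g x) = m * volume Q.carrier :=
          (ENNReal.div_mul_cancel Q.volume_ne_zero Q.volume_ne_top).symm
      _ ≤ m * (2 * volume (Q.carrier \ U)) := by gcongr
      _ = 2 * ∫⁻ _ in Q.carrier \ U, m := by rw [setLIntegral_const]; ring
      _ ≤ 2 * ∫⁻ x in Q.carrier \ U, H x := by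
          gcongr 2 * ?_
          refine setLIntegral_mono' (Q.measurableSet_carrier.diff hUm) fun x hx => ?_
          rw [hm, ENNReal.div_le_iff_le_mul (Or.inl Q.volume_ne_zero) (Or.inl Q.volume_ne_top),
            mul_comm (H x)]
          exact hH Q x hx.1
  have hout : ∫⁻ x in Q.carrier \ U, ‖f x - c Q‖ₑ * g x
      ≤ b Q * ∫⁻ x in Q.carrier \ U, g x := by
    rw [← lintegral_const_mul _ hg]
    refine setLIntegral_mono_ae (hg.const_mul _).aemeasurable ?_
    filter_upwards [measure_eq_zero_iff_ae_notMem.1 hnull] with x hx hxQ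
    have hnot : ¬ ((b Q : ℝ) < |f x - c Q|) := fun h => hx ⟨⟨hxQ.1, h⟩, hxQ.2⟩
    gcongr
    rw [Real.enorm_eq_ofReal_abs, ← ENNReal.ofReal_coe_nnreal]
    exact ENNReal.ofReal_le_ofReal (not_lt.1 hnot)
  have hin : ∀ i, ∫⁻ x in (P i).carrier, ‖f x - c Q‖ₑ * g x
      ≤ oscPairing f g b c (P i) + b Q * ∫⁻ x in (P i).carrier, g x := by
    intro i
    -- The exceptional set of `Q` fills at most half of the subcube and that of the subcube at most
    -- a quarter, so some point is good for both. There `f` is close to both constants, which bounds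
    -- their difference.
    have hex : ∃ x ∈ (P i).carrier, x ∉ E Q ∧ x ∉ E (P i) := by
      by_contra! hcon
      have hsub : (P i).carrier ⊆ (E Q ∩ (P i).carrier) ∪ E (P i) := fun x hx => by
        by_cases h : x ∈ E Q
        · exact Or.inl ⟨h, hx⟩
        · exact Or.inr (hcon x hx h)
      have h1 : volume (P i).carrier ≤ volume (E Q ∩ (P i).carrier) + volume (E (P i)) :=
        (measure_mono hsub).trans (measure_union_le _ _)
      have h2 : 4 * volume (E (P i)) ≤ volume (P i).carrier := by
        refine le_trans ?_ (hosc (P i))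
        gcongr
        calc (4 : ℝ≥0∞) = 2 ^ 2 := by norm_num
          _ ≤ 2 ^ (d + 2) := pow_le_pow_right₀ one_le_two (by omega)
      have h3 : 4 * volume (P i).carrier ≤ 3 * volume (P i).carrier := by
        calc 4 * volume (P i).carrier
            ≤ 4 * (volume (E Q ∩ (P i).carrier) + volume (E (P i))) := by gcongr
          _ = 2 * (2 * volume (E Q ∩ (P i).carrier)) + 4 * volume (E (P i)) := by ring
          _ ≤ 2 * volume (P i).carrier + volume (P i).carrier := by
              gcongr
              exact hhalf i
          _ = 3 * volume (P i).carrier := by ring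
      rw [ENNReal.mul_le_mul_iff_left (P i).volume_ne_zero (P i).volume_ne_top] at h3
      norm_num at h3
    obtain ⟨x, hx, hxQ, hxP⟩ := hex
    have h1 : |f x - c Q| ≤ b Q := not_lt.1 fun h => hxQ ⟨hPQ i hx, h⟩
    have h2 : |f x - c (P i)| ≤ b (P i) := not_lt.1 fun h => hxP ⟨hx, h⟩
    have hc : ‖c (P i) - c Q‖ₑ ≤ b Q + b (P i) := by
      rw [Real.enorm_eq_ofReal_abs, ← ENNReal.coe_add, ← ENNReal.ofReal_coe_nnreal]
      refine ENNReal.ofReal_le_ofReal ?_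
      push_cast
      rw [abs_le] at *
      constructor <;> linarith [h1.1, h1.2, h2.1, h2.2]
    calc ∫⁻ x in (P i).carrier, ‖f x - c Q‖ₑ * g x
        ≤ ∫⁻ x in (P i).carrier, (‖f x - c (P i)‖ₑ * g x + (b Q + b (P i)) * g x) := by
          refine lintegral_mono fun x => ?_
          rw [← add_mul]
          gcongr
          calc ‖f x - c Q‖ₑ = ‖(f x - c (P i)) + (c (P i) - c Q)‖ₑ := by congr 1; ring
            _ ≤ ‖f x - c (P i)‖ₑ + ‖c (P i) - c Q‖ₑ := enorm_add_le _ _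
            _ ≤ _ := by gcongr
      _ = oscPairing f g b c (P i) + b Q * ∫⁻ x in (P i).carrier, g x := by
          rw [lintegral_add_right _ (hg.const_mul _), lintegral_const_mul _ hg, oscPairing]
          ring
  calc oscPairing f g b c Q
      = b Q * (∫⁻ x in Q.carrier, g x) + ((∑' i, ∫⁻ x in (P i).carrier, ‖f x - c Q‖ₑ * g x)
          + ∫⁻ x in Q.carrier \ U, ‖f x - c Q‖ₑ * g x) := by
        rw [oscPairing, hsplit fun x => ‖f x - c Q‖ₑ * g x, hsum fun x => ‖f x - c Q‖ₑ * g x]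
    _ ≤ b Q * (∫⁻ x in Q.carrier, g x)
          + ((∑' i, (oscPairing f g b c (P i) + b Q * ∫⁻ x in (P i).carrier, g x))
          + b Q * ∫⁻ x in Q.carrier \ U, g x) := by
        gcongr with i
        exact hin i
    _ = b Q * (∫⁻ x in Q.carrier, g x) + b Q * (∫⁻ x in Q.carrier, g x)
          + ∑' i, oscPairing f g b c (P i) := by
        rw [ENNReal.tsum_add, ENNReal.tsum_mul_left, ← hsum, hsplit g]
        ring
    _ ≤ 2 * (∫⁻ x in Q.carrier \ U, H x) + 2 * (∫⁻ x in Q.carrier \ U, H x)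
          + ∑' i, oscPairing f g b c (P i) := by gcongr
    _ = _ := by ring

/-- In the iteration of the step the unselected parts are disjoint, so their integrals of `H` add up
to at most that over `Q`. The cubes remaining after `k` rounds have total measure at most `2⁻ᵏ |Q|`;
the a priori bound with `R` makes their contribution tend to `0`. -/
theorem oscPairing_le (hf : Measurable f) (hg : Measurable g)
    (hosc : ∀ Q : Cube d, 2 ^ (d + 2) * volume {x | x ∈ Q.carrier ∧ (b Q : ℝ) < |f x - c Q|}
      ≤ volume Q.carrier)
    (hH : ∀ Q : Cube d, ∀ x ∈ Q.carrier, b Q * (∫⁻ y in Q.carrier, g y) ≤ volume Q.carrier * H x)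
    {R : ℝ≥0} (hR : ∀ Q, oscPairing f g b c Q ≤ R * volume Q.carrier) (Q : Cube d) :
    oscPairing f g b c Q ≤ 4 * ∫⁻ x in Q.carrier, H x := by
  have key : ∀ (k : ℕ) (Q : Cube d), oscPairing f g b c Q
      ≤ 4 * (∫⁻ x in Q.carrier, H x) + 2⁻¹ ^ k * (R * volume Q.carrier) := by
    intro k
    induction k with
    | zero => intro Q; simpa using le_add_left (hR Q)
    | succ k ih =>
      intro Q
      obtain ⟨ι, hι, P, hdisj, hPQ, hvol, hstep⟩ := oscPairing_step hf hg hosc hH Q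
      set U := ⋃ i, (P i).carrier with hU
      have hUm : MeasurableSet U := MeasurableSet.iUnion fun i => (P i).measurableSet_carrier
      have hUQ : U ⊆ Q.carrier := iUnion_subset hPQ
      refine hstep.trans ?_
      calc 4 * (∫⁻ x in Q.carrier \ U, H x) + ∑' i, oscPairing f g b c (P i)
          ≤ 4 * (∫⁻ x in Q.carrier \ U, H x) + ∑' i, (4 * (∫⁻ x in (P i).carrier, H x)
              + 2⁻¹ ^ k * (R * volume (P i).carrier)) := by
            gcongr with i
            exact ih (P i)
        _ = 4 * ((∫⁻ x in U, H x) + ∫⁻ x in Q.carrier \ U, H x)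
              + 2⁻¹ ^ k * (R * volume U) := by
            rw [ENNReal.tsum_add, ENNReal.tsum_mul_left, ENNReal.tsum_mul_left,
              ENNReal.tsum_mul_left, hU, ← measure_iUnion hdisj
              (fun i => (P i).measurableSet_carrier),
              ← lintegral_iUnion (fun i => (P i).measurableSet_carrier) hdisj]
            ring
        _ ≤ 4 * (∫⁻ x in Q.carrier, H x) + 2⁻¹ ^ k * (R * (2⁻¹ * volume Q.carrier)) := by
            rw [← lintegral_inter_add_sdiff H Q.carrier hUm, inter_eq_self_of_subset_right hUQ]
            gcongr
            rwa [← ENNReal.div_eq_inv_mul, ENNReal.le_div_iff_mul_le (Or.inl two_ne_zero)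
              (Or.inl ENNReal.ofNat_ne_top), mul_comm]
        _ = _ := by ring
  have hlim : Tendsto (fun k : ℕ => 4 * (∫⁻ x in Q.carrier, H x)
      + (2⁻¹ : ℝ≥0∞) ^ k * (R * volume Q.carrier)) atTop
      (𝓝 (4 * (∫⁻ x in Q.carrier, H x) + 0 * (R * volume Q.carrier))) := by
    refine tendsto_const_nhds.add (ENNReal.Tendsto.mul_const ?_ (Or.inr
      (ENNReal.mul_ne_top ENNReal.coe_ne_top Q.volume_ne_top)))
    exact ENNReal.tendsto_pow_atTop_nhds_zero_of_lt_one (by simp)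
  rw [zero_mul, add_zero] at hlim
  exact ge_of_tendsto' hlim fun k => key k Q

end Core

/-! ### The sharp maximal function inequality on the whole space -/

/-- The truncation of a real number to `[-N, N]`. -/
def clamp (N t : ℝ) : ℝ := max (-N) (min N t)

theorem measurable_clamp (N : ℝ) : Measurable (clamp N) :=
  measurable_const.max (measurable_const.min measurable_id)

theorem abs_clamp_sub_clamp_le (N s t : ℝ) : |clamp N s - clamp N t| ≤ |s - t| := by
  refine (abs_max_sub_max_le_max _ _ _ _).trans ?_
  rw [sub_self, abs_zero, max_eq_right (abs_nonneg _)]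
  refine (abs_min_sub_min_le_max _ _ _ _).trans ?_
  rw [sub_self, abs_zero, max_eq_right (abs_nonneg _)]

theorem abs_clamp_le {N : ℝ} (hN : 0 ≤ N) (t : ℝ) : |clamp N t| ≤ N :=
  abs_le.2 ⟨le_max_left _ _, max_le (by linarith) (min_le_left _ _)⟩

theorem abs_clamp_le_abs {N : ℝ} (hN : 0 ≤ N) (t : ℝ) : |clamp N t| ≤ |t| := by
  have h := abs_clamp_sub_clamp_le N t 0
  have h0 : clamp N 0 = 0 := by simp [clamp, hN]
  simpa [h0] using h

theorem min_abs_le_abs_clamp {N : ℝ} (hN : 0 ≤ N) (t : ℝ) : min |t| N ≤ |clamp N t| := by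
  rcases le_total 0 t with h | h
  · rw [abs_of_nonneg h, clamp, max_eq_right (by linarith [le_min hN h]),
      abs_of_nonneg (le_min hN h), min_comm]
  · rw [clamp, min_eq_right (h.trans hN)]
    rcases max_choice (-N) t with h' | h' <;> rw [h']
    · rw [abs_neg, abs_of_nonneg hN]; exact min_le_right _ _
    · exact min_le_left _ _

theorem maximal_le_of_le {g : (Fin d → ℝ) → ℝ≥0∞} {B : ℝ≥0∞} (h : ∀ x, g x ≤ B)
    (x : Fin d → ℝ) : maximal g x ≤ B := by
  refine iSup_indicator_le fun Q _ => ?_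
  rw [setLAverage_eq, ENNReal.div_le_iff_le_mul (Or.inl Q.volume_ne_zero) (Or.inl Q.volume_ne_top)]
  exact (lintegral_mono h).trans_eq (setLIntegral_const _ _)

/-- A cube which contains a given ball and has large measure. -/
theorem exists_cube (hd : 0 < d) (n : ℕ) {L : ℝ≥0∞} (hL : L < ∞) :
    ∃ Q : Cube d, Metric.closedBall 0 (n : ℝ) ⊆ Q.carrier ∧ L < volume Q.carrier := by
  have hL0 : 0 ≤ L.toReal := ENNReal.toReal_nonneg
  set s : ℝ := 2 * n + 2 + L.toReal with hs
  have hn : (0 : ℝ) ≤ n := Nat.cast_nonneg n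
  refine ⟨⟨fun _ => -n, s, by positivity⟩, fun x hx => ?_, ?_⟩
  · rw [mem_closedBall_zero_iff] at hx
    rw [Cube.mem_carrier]
    intro i
    have h := abs_le.1 ((norm_le_pi_norm x i).trans hx)
    exact ⟨h.1, by simp only [hs]; linarith [h.2]⟩
  · rw [Cube.volume_carrier]
    have h1 : (1 : ℝ≥0∞) ≤ ENNReal.ofReal s := by
      rw [ENNReal.one_le_ofReal]; simp only [hs]; linarith
    refine lt_of_lt_of_le ?_ (le_self_pow₀ h1 hd.ne')
    rw [ENNReal.lt_ofReal_iff_toReal_lt hL.ne]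
    simp only [hs]; linarith

theorem exists_weakL1_le {f : L0 d} (hfin : ∀ Q, weakOscillation f Q < ∞) {η : ℝ≥0∞} (hη : η ≠ 0)
    (Q : Cube d) :
    ∃ c : ℝ, weakL1 (fun x => f x - c) Q ≤ (weakOscillation f Q + η) * volume Q.carrier := by
  have h : weakOscillation f Q < weakOscillation f Q + η := ENNReal.lt_add_right (hfin Q).ne hη
  obtain ⟨c, hc⟩ := iInf_lt_iff.1 h
  refine ⟨c, ?_⟩
  rw [← ENNReal.div_le_iff_le_mul (Or.inl Q.volume_ne_zero) (Or.inl Q.volume_ne_top),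
    ENNReal.div_eq_inv_mul]
  exact hc.le

/-- Truncating `f` at height `N` provides the a priori bound required for the iteration and, being
1-Lipschitz, does not increase the oscillations. The small `η` lets the infimum over constants be
nearly attained and keeps the levels positive. The constant is `2^(d+4) = 4 · 2^(d+2)`. -/
theorem setLIntegral_clamp_mul_le {f : L0 d} (hfin : ∀ Q, weakOscillation f Q < ∞)
    {g : (Fin d → ℝ) → ℝ≥0∞} (hg : Measurable g) {n : ℕ} (hgn : ∀ x, g x ≤ n) (N : ℕ)
    {α : ℝ} {Q : Cube d} (hα : 2 * volume {x | α < |f x|} < volume Q.carrier) {η : ℝ≥0}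
    (hη : 0 < η) :
    ∫⁻ x in Q.carrier, ‖clamp N (f x)‖ₑ * g x ≤ ENNReal.ofReal α * (∫⁻ x in Q.carrier, g x)
      + 2 ^ (d + 4) * ∫⁻ x in Q.carrier, (weakSharpMaximal f x + η) * maximal g x := by
  have hη' : (η : ℝ≥0∞) ≠ 0 := by exact_mod_cast hη.ne'
  choose c₀ hc₀ using exists_weakL1_le hfin hη'
  have hN : (0 : ℝ) ≤ N := Nat.cast_nonneg N
  set a : Cube d → ℝ≥0 := fun Q => (weakOscillation f Q + η).toNNReal with ha
  have haQ : ∀ Q, (a Q : ℝ≥0∞) = weakOscillation f Q + η := fun Q =>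
    ENNReal.coe_toNNReal (ENNReal.add_lt_top.2 ⟨hfin Q, ENNReal.coe_lt_top⟩).ne
  have ha0 : ∀ Q, (a Q : ℝ≥0∞) ≠ 0 := fun Q => by
    rw [haQ]; exact fun h => hη' (add_eq_zero.1 h).2
  -- At the first level the weak-type bound leaves an exceptional set of relative measure at most
  -- `2^-(d+2)`; above `2N` the exceptional set is empty, because `u` and `c Q` are both bounded by
  -- `N`. The minimum keeps `b` bounded uniformly in `Q`.
  set b : Cube d → ℝ≥0 := fun Q => min (2 ^ (d + 2) * a Q) (2 * N) with hb
  set c : Cube d → ℝ := fun Q => clamp N (c₀ Q) with hc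
  set u : (Fin d → ℝ) → ℝ := fun x => clamp N (f x) with hu
  have hum : Measurable u := (measurable_clamp N).comp (AEEqFun.measurable f)
  have hdist : ∀ Q x, |u x - c Q| ≤ 2 * N := fun Q x => by
    have h1 := abs_le.1 (abs_clamp_le hN (f x))
    have h2 := abs_le.1 (abs_clamp_le hN (c₀ Q))
    exact abs_le.2 ⟨by simp only [hu, hc]; linarith [h1.1, h2.2],
      by simp only [hu, hc]; linarith [h1.2, h2.1]⟩
  have hosc : ∀ Q : Cube d, 2 ^ (d + 2) * volume {x | x ∈ Q.carrier ∧ (b Q : ℝ) < |u x - c Q|}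
      ≤ volume Q.carrier := by
    intro Q
    rcases le_total (2 ^ (d + 2) * a Q) (2 * N) with h | h
    · have hbQ : b Q = 2 ^ (d + 2) * a Q := min_eq_left h
      have h1 : (b Q : ℝ≥0∞) * volume {x | x ∈ Q.carrier ∧ (b Q : ℝ) < |u x - c Q|}
          ≤ a Q * volume Q.carrier := by
        rw [haQ]
        refine le_trans (le_trans ?_ (le_iSup _ (b Q))) (hc₀ Q)
        refine mul_le_mul_right (measure_mono ?_) _
        rintro x ⟨hx, h2⟩
        exact ⟨hx, h2.trans_le (abs_clamp_sub_clamp_le _ _ _)⟩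
      rw [hbQ] at h1 ⊢
      push_cast at h1 ⊢
      rw [mul_comm ((2 : ℝ≥0∞) ^ (d + 2)), mul_assoc] at h1
      exact (ENNReal.mul_le_mul_iff_right (ha0 Q) ENNReal.coe_ne_top).1 h1
    · have hbQ : b Q = 2 * N := min_eq_right h
      have : {x | x ∈ Q.carrier ∧ (b Q : ℝ) < |u x - c Q|} = ∅ := by
        rw [eq_empty_iff_forall_notMem]
        rintro x ⟨-, hx⟩
        rw [hbQ] at hx
        push_cast at hx
        exact absurd (hdist Q x) (not_le.2 hx)
      simp [this]
  set H : (Fin d → ℝ) → ℝ≥0∞ := fun x =>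
    2 ^ (d + 2) * ((weakSharpMaximal f x + η) * maximal g x) with hHdef
  have hH : ∀ Q : Cube d, ∀ x ∈ Q.carrier,
      b Q * (∫⁻ y in Q.carrier, g y) ≤ volume Q.carrier * H x := by
    intro Q x hx
    have h1 : (b Q : ℝ≥0∞) ≤ 2 ^ (d + 2) * (weakSharpMaximal f x + η) := by
      calc (b Q : ℝ≥0∞) ≤ ((2 ^ (d + 2) * a Q : ℝ≥0) : ℝ≥0∞) :=
            ENNReal.coe_le_coe.2 (min_le_left _ _)
        _ = 2 ^ (d + 2) * (weakOscillation f Q + η) := by push_cast; rw [haQ]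
        _ ≤ _ := by
          gcongr
          exact le_iSup_indicator (fun Q => weakOscillation f Q) hx
    calc b Q * (∫⁻ y in Q.carrier, g y)
        ≤ 2 ^ (d + 2) * (weakSharpMaximal f x + η) * (volume Q.carrier * maximal g x) := by
          gcongr
          exact setLIntegral_le_mul_maximal g hx
      _ = volume Q.carrier * H x := by simp only [hHdef]; ring
  have hgQ : ∀ Q : Cube d, ∫⁻ y in Q.carrier, g y ≤ n * volume Q.carrier := fun Q =>
    (lintegral_mono hgn).trans_eq (setLIntegral_const _ _)
  have hR : ∀ Q, oscPairing u g b c Q ≤ ((2 * N * n + 2 * N * n : ℝ≥0) : ℝ≥0∞)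
      * volume Q.carrier := by
    intro Q
    push_cast
    rw [add_mul, oscPairing]
    refine add_le_add ?_ ?_
    · rw [mul_assoc]
      gcongr
      · calc (b Q : ℝ≥0∞) ≤ ((2 * N : ℝ≥0) : ℝ≥0∞) :=
            ENNReal.coe_le_coe.2 (min_le_right _ _)
          _ = 2 * N := by push_cast; rfl
      · exact hgQ Q
    · rw [← setLIntegral_const]
      refine lintegral_mono fun x => ?_
      gcongr
      · rw [Real.enorm_eq_ofReal_abs]
        refine (ENNReal.ofReal_le_ofReal (hdist Q x)).trans_eq ?_
        rw [ENNReal.ofReal_mul zero_le_two]; simp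
      · exact hgn x
  have hmain := oscPairing_le hum hg hosc hH hR Q
  -- On the large cube `Q`, `{|f| > α}` fills less than half and the exceptional set at most half.
  -- At a point outside both, `u` is at most `α` in absolute value and within `b Q` of `c Q`.
  have hcQ : ‖c Q‖ₑ ≤ ENNReal.ofReal α + b Q := by
    have hex : ∃ x ∈ Q.carrier, |f x| ≤ α ∧ |u x - c Q| ≤ b Q := by
      by_contra! hcon
      have hsub : Q.carrier ⊆ {x | α < |f x|} ∪ {x | x ∈ Q.carrier ∧ (b Q : ℝ) < |u x - c Q|} :=
        fun x hx => by
          by_cases h : α < |f x|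
          · exact Or.inl h
          · exact Or.inr ⟨hx, hcon x hx (not_lt.1 h)⟩
      have h1 := (measure_mono (μ := volume) hsub).trans (measure_union_le _ _)
      have h2 : 2 * volume {x | x ∈ Q.carrier ∧ (b Q : ℝ) < |u x - c Q|} ≤ volume Q.carrier := by
        refine le_trans ?_ (hosc Q)
        gcongr
        exact le_self_pow₀ one_le_two (by omega)
      have h3 : 2 * volume Q.carrier < 2 * volume Q.carrier := by
        calc 2 * volume Q.carrier ≤ 2 * volume {x | α < |f x|}
              + 2 * volume {x | x ∈ Q.carrier ∧ (b Q : ℝ) < |u x - c Q|} := by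
              rw [← mul_add]; gcongr
          _ < volume Q.carrier + volume Q.carrier :=
              ENNReal.add_lt_add_of_lt_of_le (h2.trans_lt Q.volume_lt_top).ne hα h2
          _ = 2 * volume Q.carrier := (two_mul _).symm
      exact lt_irrefl _ h3
    obtain ⟨x, -, hx1, hx2⟩ := hex
    have hux : |u x| ≤ α := (abs_clamp_le_abs hN (f x)).trans hx1
    have hα0 : 0 ≤ α := (abs_nonneg _).trans hux
    rw [Real.enorm_eq_ofReal_abs, ← ENNReal.ofReal_coe_nnreal,
      ← ENNReal.ofReal_add hα0 (NNReal.coe_nonneg _)]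
    refine ENNReal.ofReal_le_ofReal ?_
    rw [abs_le] at *
    constructor <;> linarith [hux.1, hux.2, hx2.1, hx2.2]
  calc ∫⁻ x in Q.carrier, ‖u x‖ₑ * g x
      ≤ ∫⁻ x in Q.carrier, (‖u x - c Q‖ₑ * g x + (ENNReal.ofReal α + b Q) * g x) := by
        refine lintegral_mono fun x => ?_
        rw [← add_mul]
        gcongr
        calc ‖u x‖ₑ = ‖(u x - c Q) + c Q‖ₑ := by rw [sub_add_cancel]
          _ ≤ ‖u x - c Q‖ₑ + ‖c Q‖ₑ := enorm_add_le _ _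
          _ ≤ _ := by gcongr
    _ = ENNReal.ofReal α * (∫⁻ x in Q.carrier, g x) + oscPairing u g b c Q := by
        rw [lintegral_add_right _ (hg.const_mul _), lintegral_const_mul _ hg, oscPairing]
        ring
    _ ≤ ENNReal.ofReal α * (∫⁻ x in Q.carrier, g x) + 4 * ∫⁻ x in Q.carrier, H x := by gcongr
    _ = _ := by
        rw [lintegral_const_mul' _ _ (ENNReal.pow_ne_top (by simp))]
        ring

/-- Apply the local estimate on a cube containing the support of `g` and large compared with `{|f| >
α}`. The order of limits matters: the error in `η` is proportional to `|Q|`, and `Q` depends on `α`,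
so `η → 0` comes before `α → 0`; the truncation height is removed by monotone convergence. -/
theorem lintegral_enorm_mul_le (hd : 0 < d) {f : L0 d} (hf : FiniteLevelSets f)
    (hfin : ∀ Q, weakOscillation f Q < ∞) {g : (Fin d → ℝ) → ℝ≥0∞} (hg : Measurable g) {n : ℕ}
    (hgn : ∀ x, g x ≤ n) (hsupp : ∀ x ∉ Metric.closedBall (0 : Fin d → ℝ) n, g x = 0) :
    ∫⁻ x, ‖f x‖ₑ * g x ≤ 2 ^ (d + 4) * ∫⁻ x, weakSharpMaximal f x * maximal g x := by
  set B := 2 ^ (d + 4) * ∫⁻ x, weakSharpMaximal f x * maximal g x with hB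
  have hfm : Measurable f := AEEqFun.measurable f
  have hgint : ∫⁻ x, g x < ∞ := by
    have : ∫⁻ x, g x = ∫⁻ x in Metric.closedBall (0 : Fin d → ℝ) n, g x :=
      (setLIntegral_eq_of_support_subset fun x hx => by
        by_contra h; exact hx (hsupp x h)).symm
    rw [this]
    refine ((lintegral_mono hgn).trans_eq (setLIntegral_const _ _)).trans_lt ?_
    exact ENNReal.mul_lt_top (ENNReal.natCast_lt_top n) measure_closedBall_lt_top
  simp_rw [mul_comm ‖f _‖ₑ]
  refine lintegral_mul_le_of_trunc hg hfm.enorm fun N => ?_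
  have hclamp : ∫⁻ x, g x * trunc N (fun x => ‖f x‖ₑ) x ≤ ∫⁻ x, ‖clamp N (f x)‖ₑ * g x := by
    refine lintegral_mono fun x => ?_
    rw [mul_comm]
    gcongr
    refine (indicator_le_self' (fun _ _ => zero_le) x).trans ?_
    beta_reduce
    rw [Real.enorm_eq_ofReal_abs, Real.enorm_eq_ofReal_abs, ← ENNReal.ofReal_natCast,
      ← ENNReal.ofReal_min]
    exact ENNReal.ofReal_le_ofReal (min_abs_le_abs_clamp (Nat.cast_nonneg N) _)
  refine hclamp.trans ?_
  have hstep : ∀ α : ℝ, 0 < α →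
      ∫⁻ x, ‖clamp N (f x)‖ₑ * g x ≤ ENNReal.ofReal α * (∫⁻ x, g x) + B := by
    intro α hα
    obtain ⟨Q, hQn, hQ⟩ := exists_cube hd n
      (L := 2 * volume {x | α < |f x|}) (ENNReal.mul_lt_top (by simp) (hf α hα))
    have hQeq : ∫⁻ x, ‖clamp N (f x)‖ₑ * g x = ∫⁻ x in Q.carrier, ‖clamp N (f x)‖ₑ * g x := by
      refine (setLIntegral_eq_of_support_subset fun x hx => ?_).symm
      by_contra h
      exact hx (by simp [hsupp x fun h' => h (hQn h')])
    have hη : ∀ η : ℝ≥0, 0 < η → ∫⁻ x in Q.carrier, ‖clamp N (f x)‖ₑ * g x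
        ≤ ENNReal.ofReal α * (∫⁻ x, g x) + B + η * (2 ^ (d + 4) * (n * volume Q.carrier)) := by
      intro η hη
      refine (setLIntegral_clamp_mul_le hfin hg hgn N hQ hη).trans ?_
      rw [add_assoc]
      gcongr
      · exact Measure.restrict_le_self
      · simp_rw [add_mul]
        rw [lintegral_add_right _ ((measurable_maximal g).const_mul _), mul_add]
        refine add_le_add ?_ ?_
        · rw [hB]
          gcongr
          exact Measure.restrict_le_self
        · rw [lintegral_const_mul _ (measurable_maximal g), mul_left_comm]
          gcongr
          exact (lintegral_mono (maximal_le_of_le hgn)).trans_eq (setLIntegral_const _ _)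
    rw [hQeq]
    have hlim : Tendsto (fun k : ℕ => ENNReal.ofReal α * (∫⁻ x, g x) + B
        + (((k : ℝ≥0) + 1)⁻¹ : ℝ≥0) * (2 ^ (d + 4) * (n * volume Q.carrier))) atTop
        (𝓝 (ENNReal.ofReal α * (∫⁻ x, g x) + B + (0 : ℝ≥0)
          * (2 ^ (d + 4) * (n * volume Q.carrier)))) := by
      refine tendsto_const_nhds.add (ENNReal.Tendsto.mul_const ?_ (Or.inr ?_))
      · refine ENNReal.tendsto_coe.2 ?_
        simpa using NNReal.tendsto_coe.1 (by
          push_cast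
          simpa using tendsto_one_div_add_atTop_nhds_zero_nat (𝕜 := ℝ))
      · exact ENNReal.mul_ne_top (ENNReal.pow_ne_top (by simp))
          (ENNReal.mul_ne_top (by simp) Q.volume_ne_top)
    rw [ENNReal.coe_zero, zero_mul, add_zero] at hlim
    exact ge_of_tendsto' hlim fun k => hη _ (by positivity)
  have hlim : Tendsto (fun k : ℕ => ENNReal.ofReal (1 / ((k : ℝ) + 1)) * (∫⁻ x, g x) + B) atTop
      (𝓝 (ENNReal.ofReal 0 * (∫⁻ x, g x) + B)) := by
    refine (ENNReal.Tendsto.mul_const ?_ (Or.inr hgint.ne)).add tendsto_const_nhds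
    exact ENNReal.tendsto_ofReal tendsto_one_div_add_atTop_nhds_zero_nat
  rw [ENNReal.ofReal_zero, zero_mul, zero_add] at hlim
  exact ge_of_tendsto' hlim fun k => hstep _ (by positivity)

namespace FunctionNorm

variable (X : FunctionNorm d)

/-- The Fefferman-Stein inequality. -/
theorem norm_le_weakSharpMaximal (hd : 0 < d) (hM : maximalOpNorm X.dual < ∞) {f : L0 d}
    (hf : FiniteLevelSets f) (hsharp : X.toFun (weakSharpMaximal f) < ∞) :
    X.norm f ≤ 2 ^ (d + 4) * maximalOpNorm X.dual * X.toFun (weakSharpMaximal f) := by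
  -- An infinite oscillation on `Q` would make the sharp maximal function infinite on all of `Q`, a
  -- set of positive measure.
  have hfin : ∀ Q, weakOscillation f Q < ∞ := by
    intro Q
    have hae := X.ae_lt_top (measurable_weakSharpMaximal f) hsharp
    by_contra hQ
    have hsub : Q.carrier ⊆ {x | ¬ weakSharpMaximal f x < ∞} := fun x hx h =>
      hQ ((le_iSup_indicator (fun Q => weakOscillation f Q) hx).trans_lt h)
    exact Q.volume_ne_zero (measure_mono_null hsub (ae_iff.1 hae))
  refine X.toFun_le_of_lintegral_mul_le (AEEqFun.measurable f).enorm
    fun g n hg hgn hsupp hdual => ?_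
  calc ∫⁻ x, ‖f x‖ₑ * g x ≤ 2 ^ (d + 4) * ∫⁻ x, weakSharpMaximal f x * maximal g x :=
        lintegral_enorm_mul_le hd hf hfin hg hgn hsupp
    _ ≤ 2 ^ (d + 4) * (X.toFun (weakSharpMaximal f) * (maximalOpNorm X.dual * X.dual g)) := by
        gcongr
        refine (X.lintegral_mul_le_dual (measurable_weakSharpMaximal f) hsharp _).trans ?_
        gcongr
        exact apply_maximal_le hM hg hdual
    _ = _ := by ring

end FunctionNorm

/-! ### Weights -/

/-- The density theorem for cubes having `x` as lower corner. Such small cubes fit into every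
half-open cube containing `x`, even if `x` is on its boundary. -/
theorem ae_measure_inter_cube_ne_zero {S : Set (Fin d → ℝ)} (hS : MeasurableSet S) :
    ∀ᵐ x ∂volume, x ∈ S → ∀ δ (hδ : 0 < δ), volume (S ∩ (Cube.of x δ hδ).carrier) ≠ 0 := by
  have h := IsUnifLocDoublingMeasure.ae_tendsto_measure_inter_div
    (volume : Measure (Fin d → ℝ)) S 1
  rw [ae_restrict_iff' hS] at h
  filter_upwards [h] with x hx hxS δ hδ h0
  have hpos : ∀ n : ℕ, 0 < 1 / ((n : ℝ) + 1) := fun n => by positivity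
  set P : ℕ → Cube d := fun n => Cube.of x (1 / ((n : ℝ) + 1)) (hpos n) with hP
  have hlim : Tendsto (fun n => (P n).side / 2) atTop (𝓝[>] 0) := by
    refine tendsto_nhdsWithin_iff.2 ⟨?_, Eventually.of_forall fun n => half_pos (P n).side_pos⟩
    have h0 := (tendsto_one_div_add_atTop_nhds_zero_nat (𝕜 := ℝ)).div_const 2
    rw [zero_div] at h0
    exact h0
  have h1 := hx hxS (fun n i => (P n).corner i + (P n).side / 2) (fun n => (P n).side / 2) hlim
    (Eventually.of_forall fun n => by
      rw [one_mul]
      exact (P n).carrier_subset_closedBall (Cube.mem_of _ _ _))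
  have h2 : ∀ᶠ n : ℕ in atTop, 1 / ((n : ℝ) + 1) < δ :=
    tendsto_one_div_add_atTop_nhds_zero_nat.eventually (gt_mem_nhds hδ)
  obtain ⟨n, hn1, hn2⟩ := ((h1.eventually (lt_mem_nhds zero_lt_one)).and h2).exists
  rw [← measure_congr ((ae_eq_refl S).inter (P n).carrier_ae_eq_closedBall)] at hn1
  have hsub : (P n).carrier ⊆ (Cube.of x δ hδ).carrier := fun y hy => by
    rw [Cube.mem_carrier] at hy ⊢
    exact fun i => ⟨(hy i).1, (hy i).2.trans (add_lt_add_right hn2 (x i))⟩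
  rw [measure_mono_null (inter_subset_inter_right S hsub) h0, ENNReal.zero_div] at hn1
  exact lt_irrefl _ hn1

/-- The exceptional null set must serve uncountably many cubes. It is taken from the countably many
superlevel sets at rational heights: if `|w x|` exceeded a height `q` above the essential supremum,
`{|w| > q}` would have positive measure in every small cube at `x`, hence in `Q`. -/
theorem ae_forall_le_essSupOn {w : (Fin d → ℝ) → ℝ} (hw : Measurable w) :
    ∀ᵐ x ∂volume, ∀ Q : Cube d, x ∈ Q.carrier → ‖w x‖ₑ ≤ essSupOn w Q := by
  set S : ℚ → Set (Fin d → ℝ) := fun q => {x | (Real.toNNReal q : ℝ≥0∞) < ‖w x‖ₑ} with hS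
  have hSm : ∀ q, MeasurableSet (S q) := fun q => measurableSet_lt measurable_const hw.enorm
  filter_upwards [ae_all_iff.2 fun q => ae_measure_inter_cube_ne_zero (hSm q)] with x hx Q hxQ
  by_contra! hlt
  obtain ⟨q, -, hq1, hq2⟩ := ENNReal.lt_iff_exists_rat_btwn.1 hlt
  rw [Cube.mem_carrier] at hxQ
  obtain ⟨δ, hδ, hsub⟩ : ∃ (δ : ℝ) (hδ : 0 < δ), (Cube.of x δ hδ).carrier ⊆ Q.carrier := by
    have h1 : ∀ i, ∀ᶠ δ in 𝓝[>] (0 : ℝ), x i + δ < Q.corner i + Q.side := fun i => by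
      have : Tendsto (fun δ : ℝ => x i + δ) (𝓝[>] 0) (𝓝 (x i + 0)) :=
        (tendsto_const_nhds.add tendsto_id).mono_left nhdsWithin_le_nhds
      exact this.eventually (gt_mem_nhds (by simpa using (hxQ i).2))
    obtain ⟨δ, hδ1, hδ2⟩ := ((eventually_all.2 h1).and self_mem_nhdsWithin).exists
    refine ⟨δ, hδ2, fun y hy => ?_⟩
    rw [Cube.mem_carrier] at hy ⊢
    exact fun i => ⟨(hxQ i).1.trans (hy i).1, (hy i).2.trans (hδ1 i)⟩
  refine hx q hq2 δ hδ (measure_mono_null (inter_subset_inter_right _ hsub) ?_)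
  rw [← Measure.restrict_apply (hSm q)]
  refine measure_mono_null ?_ (ae_iff.1 (ae_le_essSup (f := fun x => ‖w x‖ₑ)
    (μ := volume.restrict Q.carrier)))
  intro y hy hle
  exact absurd (hy.trans_le hle) (not_lt.2 hq1.le)

/-- On any single cube the mean of `v` is at least the reciprocal of the essential supremum of
`v⁻¹`. The bound places the `A₁` constant in `[1, ∞)`, where `φ` is monotone. -/
theorem one_le_A1Const {v : (Fin d → ℝ) → ℝ} (hv : Measurable v) (hpos : ∀ᵐ x ∂volume, 0 < v x) :
    1 ≤ A1Const v := by
  set Q : Cube d := Cube.of 0 1 one_pos with hQ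
  refine le_trans ?_ (le_iSup _ Q)
  set s := essSupOn (fun x => (v x)⁻¹) Q with hs
  have hae : ∀ᵐ x ∂volume.restrict Q.carrier, s⁻¹ ≤ ‖v x‖ₑ := by
    filter_upwards [ae_le_essSup (f := fun x => ‖(v x)⁻¹‖ₑ) (μ := volume.restrict Q.carrier),
      ae_restrict_of_ae hpos] with x hx hx0
    rw [enorm_inv hx0.ne'] at hx
    exact ENNReal.inv_le_iff_inv_le.1 hx
  have hs0 : s ≠ 0 := by
    intro h
    rw [h, ENNReal.inv_zero] at hae
    have : volume Q.carrier = 0 := by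
      rw [← Measure.restrict_apply_univ]
      refine measure_mono_null ?_ (ae_iff.1 hae)
      exact fun x _ h => enorm_ne_top (top_le_iff.1 h)
    exact Q.volume_ne_zero this
  have havg : s⁻¹ ≤ ⨍⁻ x in Q.carrier, ‖v x‖ₑ ∂volume := by
    rw [setLAverage_eq, ENNReal.le_div_iff_mul_le (Or.inl Q.volume_ne_zero)
      (Or.inl Q.volume_ne_top), ← setLIntegral_const]
    exact lintegral_mono_ae hae
  by_cases htop : s = ∞
  · have hne : ⨍⁻ x in Q.carrier, ‖v x‖ₑ ∂volume ≠ 0 := by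
      rw [setLAverage_eq]
      refine ENNReal.div_ne_zero.2 ⟨fun h => ?_, Q.volume_ne_top⟩
      rw [lintegral_eq_zero_iff hv.enorm] at h
      refine Q.volume_ne_zero ?_
      rw [← Measure.restrict_apply_univ]
      refine measure_mono_null ?_ (ae_iff.1 (h.and (ae_restrict_of_ae hpos)))
      rintro x - ⟨h1, h2⟩
      exact h2.ne' (by simpa using h1)
    rw [htop, ENNReal.mul_top hne]
    exact le_top
  · calc (1 : ℝ≥0∞) = s⁻¹ * s := (ENNReal.inv_mul_cancel hs0 htop).symm
      _ ≤ _ := by gcongr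

theorem A1Const_toReal_le {v : (Fin d → ℝ) → ℝ≥0∞} (hpos : ∀ x, v x ≠ 0)
    (hfin : ∀ᵐ x ∂volume, v x < ∞) {B : ℝ≥0∞} (hB : B < ∞) (h : ∀ x, maximal v x ≤ B * v x) :
    A1Const (fun x => (v x).toReal) ≤ B := by
  refine iSup_le fun Q => ?_
  have havg : ⨍⁻ x in Q.carrier, ‖(v x).toReal‖ₑ ∂volume = ⨍⁻ x in Q.carrier, v x ∂volume := by
    rw [setLAverage_eq, setLAverage_eq]
    congr 1
    refine lintegral_congr_ae ?_
    filter_upwards [ae_restrict_of_ae hfin] with x hx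
    exact Real.enorm_toReal hx.ne
  rw [havg]
  set a := ⨍⁻ x in Q.carrier, v x ∂volume with ha
  have hle : ∀ x ∈ Q.carrier, a ≤ B * v x := fun x hx =>
    (le_iSup_indicator (fun Q : Cube d => ⨍⁻ x in Q.carrier, v x ∂volume) hx).trans (h x)
  by_cases ha0 : a = 0
  · simp [ha0]
  have hess : essSupOn (fun x => ((v x).toReal)⁻¹) Q ≤ B / a := by
    refine essSup_le_of_ae_le _ ?_
    filter_upwards [ae_restrict_of_ae hfin, ae_restrict_mem Q.measurableSet_carrier] with x hx hxQ
    have hx0 := hpos x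
    rw [enorm_inv (ENNReal.toReal_pos hx0 hx.ne).ne', Real.enorm_toReal hx.ne]
    have haB := hle x hxQ
    have hatop : a ≠ ∞ := (haB.trans_lt (ENNReal.mul_lt_top hB hx)).ne
    rw [ENNReal.le_div_iff_mul_le (Or.inl ha0) (Or.inl hatop)]
    calc (v x)⁻¹ * a ≤ (v x)⁻¹ * (B * v x) := by gcongr
      _ = B * ((v x)⁻¹ * v x) := by ring
      _ = B := by rw [ENNReal.inv_mul_cancel hx0 hx.ne, mul_one]
  calc a * essSupOn (fun x => ((v x).toReal)⁻¹) Q ≤ a * (B / a) := by gcongr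
    _ ≤ B := ENNReal.mul_div_le

/-! ### The Rubio de Francia algorithm -/

/-- Every point lies in cubes containing arbitrarily large balls, so a zero of the maximal function
forces all integrals of `f` over such balls to vanish. -/
theorem maximal_ne_zero (hd : 0 < d) {f : (Fin d → ℝ) → ℝ≥0∞} (hf : Measurable f)
    (h : ¬ f =ᵐ[volume] 0) (x : Fin d → ℝ) : maximal f x ≠ 0 := by
  intro h0
  refine h ?_
  obtain ⟨N, hN⟩ := exists_nat_ge ‖x‖
  have hball : ∀ n : ℕ, ∫⁻ y in Metric.closedBall (0 : Fin d → ℝ) (N + n : ℕ), f y = 0 := by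
    intro n
    obtain ⟨Q, hQ, -⟩ := exists_cube hd (N + n) ENNReal.zero_lt_top
    have hxQ : x ∈ Q.carrier := hQ (by
      rw [mem_closedBall_zero_iff]; push_cast
      exact hN.trans (le_add_of_nonneg_right n.cast_nonneg))
    have h1 := setLIntegral_le_mul_maximal f hxQ
    rw [h0, mul_zero] at h1
    exact le_antisymm ((lintegral_mono_set hQ).trans h1) zero_le
  have hun : ⋃ n : ℕ, Metric.closedBall (0 : Fin d → ℝ) (N + n : ℕ) = univ := by
    refine eq_univ_of_forall fun y => ?_
    obtain ⟨n, hn⟩ := exists_nat_ge ‖y‖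
    refine mem_iUnion.2 ⟨n, ?_⟩
    rw [mem_closedBall_zero_iff]; push_cast
    exact hn.trans (le_add_of_nonneg_left N.cast_nonneg)
  rw [← lintegral_eq_zero_iff hf, ← setLIntegral_univ, ← hun]
  refine le_antisymm ((lintegral_iUnion_le _ _).trans ?_) zero_le
  simp_rw [hball, tsum_zero]
  exact le_rfl

theorem maximal_tsum_le {u : ℕ → (Fin d → ℝ) → ℝ≥0∞} (hu : ∀ k, Measurable (u k))
    (x : Fin d → ℝ) : maximal (fun y => ∑' k, u k y) x ≤ ∑' k, maximal (u k) x := by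
  refine iSup_indicator_le fun Q hx => ?_
  rw [setLAverage_eq, ENNReal.div_le_iff_le_mul (Or.inl Q.volume_ne_zero) (Or.inl Q.volume_ne_top),
    lintegral_tsum fun k => (hu k).aemeasurable, ← ENNReal.tsum_mul_right]
  refine ENNReal.tsum_le_tsum fun k => ?_
  rw [mul_comm]
  exact setLIntegral_le_mul_maximal (u k) hx

theorem maximal_const_mul_le (c : ℝ≥0) {u : (Fin d → ℝ) → ℝ≥0∞} (hu : Measurable u)
    (x : Fin d → ℝ) : maximal (fun y => c * u y) x ≤ c * maximal u x := by
  refine iSup_indicator_le fun Q hx => ?_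
  rw [setLAverage_eq, ENNReal.div_le_iff_le_mul (Or.inl Q.volume_ne_zero) (Or.inl Q.volume_ne_top),
    lintegral_const_mul _ hu, mul_assoc, mul_comm (maximal u x)]
  gcongr
  exact setLIntegral_le_mul_maximal u hx

/-- The function is `∑ (2A)⁻ᵏ Mᵏ f`. Each term has norm at most `2⁻ᵏ ‖f‖`, and applying `M` to a
term gives at most `2A` times the next one, so `M` acts on the series as a shift. -/
theorem FunctionNorm.exists_rubioDeFrancia (X : FunctionNorm d) (hd : 0 < d)
    (hM : maximalOpNorm X.toFun < ∞) {f : (Fin d → ℝ) → ℝ≥0∞} (hf : Measurable f)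
    (hfX : X.toFun f < ∞) (hf0 : X.toFun f ≠ 0) :
    ∃ v : (Fin d → ℝ) → ℝ≥0∞, Measurable v ∧ (∀ x, f x ≤ v x) ∧ (∀ x, v x ≠ 0) ∧
      X.toFun v ≤ 2 * X.toFun f ∧
      ∀ x, maximal v x ≤ 2 * maximalOpNorm X.toFun * v x := by
  set A := maximalOpNorm X.toFun with hA
  have hpos := maximal_ne_zero hd hf (fun h => hf0 ((X.eq_zero_iff f hf).2 h))
  have hA0 : A ≠ 0 := by
    intro h
    have h1 := apply_maximal_le hM hf hfX
    rw [← hA, h, zero_mul] at h1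
    have h2 := (X.eq_zero_iff _ (measurable_maximal f)).1 (le_antisymm h1 zero_le)
    have h3 : volume (univ : Set (Fin d → ℝ)) = 0 :=
      measure_mono_null (fun x _ => by exact hpos x) (ae_iff.1 h2)
    refine (Cube.of (0 : Fin d → ℝ) 1 one_pos).volume_ne_zero (measure_mono_null ?_ h3)
    exact subset_univ _
  have h2A0 : 2 * A ≠ 0 := mul_ne_zero two_ne_zero hA0
  have h2A : 2 * A ≠ ∞ := ENNReal.mul_ne_top (by simp) hM.ne
  set r : ℝ≥0 := (2 * A)⁻¹.toNNReal with hr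
  have hrA : (r : ℝ≥0∞) = (2 * A)⁻¹ := ENNReal.coe_toNNReal (ENNReal.inv_ne_top.2 h2A0)
  set m : ℕ → (Fin d → ℝ) → ℝ≥0∞ := fun k => maximal^[k] f with hm
  have hms : ∀ k, m (k + 1) = maximal (m k) := fun k => Function.iterate_succ_apply' _ _ _
  have hmm : ∀ k, Measurable (m k) := by
    intro k
    cases k with
    | zero => exact hf
    | succ k => rw [hms]; exact measurable_maximal _
  have hmX : ∀ k, X.toFun (m k) ≤ A ^ k * X.toFun f := by
    intro k
    induction k with
    | zero => simp [hm]
    | succ k ih =>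
      rw [hms, pow_succ', mul_assoc]
      refine (apply_maximal_le hM (hmm k) (ih.trans_lt ?_)).trans (by gcongr)
      exact ENNReal.mul_lt_top (ENNReal.pow_lt_top hM) hfX
  set u : ℕ → (Fin d → ℝ) → ℝ≥0∞ := fun k x => ((r ^ k : ℝ≥0) : ℝ≥0∞) * m k x with hu
  have hum : ∀ k, Measurable (u k) := fun k => (hmm k).const_mul _
  have hstep : ∀ k x, maximal (u k) x ≤ 2 * A * u (k + 1) x := by
    intro k x
    refine (maximal_const_mul_le _ (hmm k) x).trans_eq ?_
    simp only [hu]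
    rw [hms, pow_succ]
    push_cast
    rw [hrA]
    calc (2 * A)⁻¹ ^ k * maximal (m k) x
        = ((2 * A) * (2 * A)⁻¹) * ((2 * A)⁻¹ ^ k * maximal (m k) x) := by
          rw [ENNReal.mul_inv_cancel h2A0 h2A, one_mul]
      _ = _ := by ring
  refine ⟨fun x => ∑' k, u k x, Measurable.tsum hum, fun x => ?_, fun x => ?_, ?_, fun x => ?_⟩
  · calc f x = u 0 x := by simp [hu, hm]
      _ ≤ _ := ENNReal.le_tsum 0
  -- The term with `k = 1` is used because `M f`, unlike `f`, is positive everywhere.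
  · refine ((pos_iff_ne_zero.2 ?_).trans_le (ENNReal.le_tsum 1)).ne'
    have : m 1 = maximal f := rfl
    simp only [hu, this, pow_one]
    refine mul_ne_zero ?_ (hpos x)
    rw [hrA]
    exact ENNReal.inv_ne_zero.2 h2A
  · refine (X.toFun_tsum_le hum).trans ?_
    calc ∑' k, X.toFun (u k) ≤ ∑' k : ℕ, (2⁻¹ : ℝ≥0∞) ^ k * X.toFun f := by
          refine ENNReal.tsum_le_tsum fun k => ?_
          simp only [hu]
          rw [X.smul_eq _ _ (hmm k)]
          push_cast
          rw [hrA, ENNReal.mul_inv (Or.inl two_ne_zero) (Or.inl (by simp)), mul_pow, mul_assoc]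
          gcongr
          calc A⁻¹ ^ k * X.toFun (m k) ≤ A⁻¹ ^ k * (A ^ k * X.toFun f) := by
                gcongr
                exact hmX k
            _ = (A⁻¹ * A) ^ k * X.toFun f := by ring
            _ = X.toFun f := by rw [ENNReal.inv_mul_cancel hA0 hM.ne, one_pow, one_mul]
      _ = 2 * X.toFun f := by
          rw [ENNReal.tsum_mul_right, ENNReal.tsum_geometric, ENNReal.one_sub_inv_two, inv_inv]
  · refine (maximal_tsum_le hum x).trans ?_
    rw [← ENNReal.tsum_mul_left]
    refine (ENNReal.tsum_le_tsum fun k => hstep k x).trans ?_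
    rw [ENNReal.tsum_mul_left, ENNReal.tsum_mul_left]
    refine mul_le_mul_right ?_ _
    exact ENNReal.tsum_comp_le_tsum_of_injective (add_left_injective 1) fun k => u k x

/-! ### Extrapolation -/

theorem ae_enorm_mul_le {w : (Fin d → ℝ) → ℝ} (hw : Measurable w) {a : Cube d → ℝ≥0∞} {C : ℝ≥0∞}
    (h : ⨆ Q, essSupOn w Q * a Q ≤ C) :
    ∀ᵐ x ∂volume, ∀ Q : Cube d, x ∈ Q.carrier → ‖w x‖ₑ * a Q ≤ C := by
  filter_upwards [ae_forall_le_essSupOn hw] with x hx Q hxQ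
  exact (mul_le_mul_left (hx Q hxQ) _).trans ((le_iSup (fun Q => essSupOn w Q * a Q) Q).trans h)

/-- A majorant of the maximal operator built from the oscillations `O` of `T f`, where `O` is one
of `oscillation` and `weakOscillation`. -/
theorem exists_majorant (hd : 0 < d) {T : L0 d → L0 d} {φ : ℝ → ℝ} (hφ : MonotoneOn φ (Ici 1))
    {O : L0 d → Cube d → ℝ≥0∞}
    (hT : WeightedBound (fun w f => ⨆ Q : Cube d, essSupOn w Q * O f Q) φ T)
    {X : FunctionNorm d} (hM : maximalOpNorm X.toFun < ∞) {f : L0 d} (hf : f ∈ X.compactPart) :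
    ∃ v : (Fin d → ℝ) → ℝ≥0∞, Measurable v ∧ X.toFun v ≤ 2 * X.norm f ∧
      ∀ᵐ x ∂volume, ⨆ Q : Cube d, Q.carrier.indicator (fun _ => O (T f) Q) x
        ≤ ENNReal.ofReal (φ (2 * (maximalOpNorm X.toFun).toReal)) * v x := by
  have hfm : Measurable fun x => ‖f x‖ₑ := (AEEqFun.measurable f).enorm
  by_cases h0 : X.norm f = 0
  -- For `f = 0` the series vanishes and has no reciprocal. The constant weight `1` shows instead
  -- that all oscillations of `T f` are zero.
  · refine ⟨0, measurable_zero, by simp [X.toFun_zero], ?_⟩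
    have hf0 : (fun x => ‖f x‖ₑ) =ᵐ[volume] 0 := (X.eq_zero_iff _ hfm).1 h0
    have hwf : weightedLinfty (fun _ => (1 : ℝ)) f = 0 := by
      refine le_antisymm (essSup_le_of_ae_le _ ?_) zero_le
      filter_upwards [hf0] with x hx
      simpa using hx
    have hA1 : A1Const (fun _ : Fin d → ℝ => (1 : ℝ))⁻¹ < ∞ := by
      have h1 := A1Const_toReal_le (d := d) (v := fun _ => 1) (by simp) (by simp)
        (ENNReal.one_lt_top) (fun x => by simpa using maximal_le_of_le (fun _ => le_rfl) x)
      have h2 : (fun _ : Fin d → ℝ => (1 : ℝ))⁻¹ = fun _ => (1 : ℝ≥0∞).toReal := by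
        funext x; simp
      rw [h2]
      exact h1.trans_lt ENNReal.one_lt_top
    have hN := hT (fun _ => 1) ⟨measurable_const, by simp⟩ hA1 f hf.2 (by simp [hwf])
    rw [hwf, mul_zero] at hN
    filter_upwards [ae_enorm_mul_le measurable_const hN] with x hx
    refine iSup_indicator_le fun Q hxQ => ?_
    simpa using hx Q hxQ
  obtain ⟨v, hv, hfv, hv0, hvX, hMv⟩ := X.exists_rubioDeFrancia hd hM hfm hf.1 h0
  refine ⟨v, hv, hvX, ?_⟩
  set A := maximalOpNorm X.toFun with hA
  have hvfin := X.ae_lt_top hv (hvX.trans_lt (ENNReal.mul_lt_top (by simp) hf.1))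
  have h2A : 2 * A < ∞ := ENNReal.mul_lt_top (by simp) hM
  set V : (Fin d → ℝ) → ℝ := fun x => (v x).toReal with hV
  have hVm : Measurable V := hv.ennreal_toReal
  have hVpos : ∀ᵐ x ∂volume, 0 < V x := by
    filter_upwards [hvfin] with x hx using ENNReal.toReal_pos (hv0 x) hx.ne
  have hA1 : A1Const V ≤ 2 * A := A1Const_toReal_le hv0 hvfin h2A hMv
  have hA1' : 1 ≤ A1Const V := one_le_A1Const hVm hVpos
  have hVinv : ∀ᵐ x ∂volume, ‖V⁻¹ x‖ₑ = (v x)⁻¹ := by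
    filter_upwards [hvfin, hVpos] with x hx hx0
    rw [Pi.inv_apply, enorm_inv hx0.ne', Real.enorm_toReal hx.ne]
  have hwf : weightedLinfty V⁻¹ f ≤ 1 := by
    refine essSup_le_of_ae_le _ ?_
    filter_upwards [hvfin, hVinv] with x hx hx1
    rw [enorm_mul, hx1, ← ENNReal.mul_inv_cancel (hv0 x) hx.ne]
    gcongr
    exact hfv x
  have hN := hT V⁻¹ ⟨hVm.inv, by filter_upwards [hVpos] with x hx using inv_pos.2 hx⟩
    (by rw [inv_inv]; exact hA1.trans_lt h2A) f hf.2 (hwf.trans_lt ENNReal.one_lt_top)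
  rw [inv_inv] at hN
  have hone : 1 ≤ (A1Const V).toReal := by
    simpa using ENNReal.toReal_mono (hA1.trans_lt h2A).ne hA1'
  have hle : (A1Const V).toReal ≤ 2 * A.toReal := by
    simpa using ENNReal.toReal_mono h2A.ne hA1
  have hN' : ⨆ Q : Cube d, essSupOn V⁻¹ Q * O (T f) Q ≤ ENNReal.ofReal (φ (2 * A.toReal)) := by
    refine hN.trans ((mul_le_of_le_one_right' hwf).trans ?_)
    exact ENNReal.ofReal_le_ofReal (hφ hone (hone.trans hle) hle)
  filter_upwards [ae_enorm_mul_le hVm.inv hN', hvfin, hVinv] with x hx hx1 hx2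
  refine iSup_indicator_le fun Q hxQ => ?_
  have h := hx Q hxQ
  rw [hx2, ← ENNReal.div_eq_inv_mul, ENNReal.div_le_iff_le_mul (Or.inl (hv0 x)) (Or.inl hx1.ne)] at h
  exact h

/-! ### From the majorant to norm bounds -/

namespace FunctionNorm

variable (X : FunctionNorm d)

/-- The infimum is attained: one divides by the norm of `N f`, and if that is `0` any finite
admissible constant will do. -/
theorem norm_le_sInf_mul {N : L0 d → (Fin d → ℝ) → ℝ≥0∞}
    (hC : sInf {C | ∀ f ∈ X.space, FiniteLevelSets f → X.norm f ≤ C * X.toFun (N f)} < ∞)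
    {f : L0 d} (hf : f ∈ X.space) (hf' : FiniteLevelSets f) (h : X.toFun (N f) < ∞) :
    X.norm f ≤ sInf {C | ∀ f ∈ X.space, FiniteLevelSets f → X.norm f ≤ C * X.toFun (N f)}
      * X.toFun (N f) := by
  by_cases h0 : X.toFun (N f) = 0
  · obtain ⟨C, hC, -⟩ := sInf_lt_iff.1 hC
    simpa [h0] using hC f hf hf'
  rw [← ENNReal.div_le_iff_le_mul (Or.inl h0) (Or.inl h.ne)]
  refine le_sInf fun C hC => ?_
  rw [ENNReal.div_le_iff_le_mul (Or.inl h0) (Or.inl h.ne)]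
  exact hC f hf hf'

theorem weakSharpConst_lt_top (hd : 0 < d) (hM : maximalOpNorm X.dual < ∞) :
    X.weakSharpConst < ∞ := by
  -- The added `1` makes the constant nonzero, so that the inequality also holds when the sharp
  -- maximal function has infinite norm.
  have hfin : 2 ^ (d + 4) * (maximalOpNorm X.dual + 1) < ∞ :=
    ENNReal.mul_lt_top (ENNReal.pow_lt_top (by simp))
      (ENNReal.add_lt_top.2 ⟨hM, ENNReal.one_lt_top⟩)
  refine lt_of_le_of_lt (sInf_le fun f _ hf => ?_) hfin
  by_cases h : X.toFun (weakSharpMaximal f) < ∞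
  · refine (X.norm_le_weakSharpMaximal hd hM hf h).trans ?_
    gcongr
    exact le_self_add
  · rw [not_lt_top_iff.1 h, ENNReal.mul_top (mul_ne_zero (by positivity) (by simp))]
    exact le_top

theorem sharpConst_le_weakSharpConst : X.sharpConst ≤ X.weakSharpConst := by
  refine le_sInf fun C hC => sInf_le fun f hf hf' => (hC f hf hf').trans ?_
  gcongr
  exact X.toFun_mono (measurable_weakSharpMaximal f) (measurable_sharpMaximal f)
    (Eventually.of_forall (weakSharpMaximal_le_sharpMaximal f))

theorem toFun_le_of_ae_le_mul {u v : (Fin d → ℝ) → ℝ≥0∞} (hu : Measurable u) (hv : Measurable v)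
    {a : ℝ} (h : ∀ᵐ x ∂volume, u x ≤ ENNReal.ofReal a * v x) :
    X.toFun u ≤ ENNReal.ofReal a * X.toFun v :=
  (X.toFun_mono hu (hv.const_mul _) h).trans_eq (X.smul_eq a.toNNReal v hv)

/-- The bounds on the compactly supported functions follow from a majorant of the weak sharp
maximal function. -/
theorem norm_le_of_majorant (hd : 0 < d) (hM : maximalOpNorm X.dual < ∞) {f g : L0 d}
    (hg : FiniteLevelSets g) {v : (Fin d → ℝ) → ℝ≥0∞} (hv : Measurable v) {a : ℝ}
    (hf : f ∈ X.space) (hvX : X.toFun v ≤ 2 * X.norm f)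
    (h : ∀ᵐ x ∂volume, weakSharpMaximal g x ≤ ENNReal.ofReal a * v x) :
    g ∈ X.space ∧
      X.norm g ≤ 2 ^ (d + 5) * maximalOpNorm X.dual * ENNReal.ofReal a * X.norm f := by
  have h1 : X.toFun (weakSharpMaximal g) ≤ ENNReal.ofReal a * (2 * X.norm f) :=
    (X.toFun_le_of_ae_le_mul (measurable_weakSharpMaximal g) hv h).trans (by gcongr)
  have hf' : X.norm f < ∞ := hf
  have h2 : X.norm g ≤ 2 ^ (d + 5) * maximalOpNorm X.dual * ENNReal.ofReal a * X.norm f := by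
    refine (X.norm_le_weakSharpMaximal hd hM hg (h1.trans_lt ?_)).trans ?_
    · exact ENNReal.mul_lt_top ENNReal.ofReal_lt_top (ENNReal.mul_lt_top (by simp) hf')
    · calc 2 ^ (d + 4) * maximalOpNorm X.dual * X.toFun (weakSharpMaximal g)
          ≤ 2 ^ (d + 4) * maximalOpNorm X.dual * (ENNReal.ofReal a * (2 * X.norm f)) := by gcongr
        _ = _ := by ring
  refine ⟨lt_of_le_of_lt h2 ?_, h2⟩
  exact ENNReal.mul_lt_top (ENNReal.mul_lt_top (ENNReal.mul_lt_top
    (ENNReal.pow_lt_top (by simp)) hM) ENNReal.ofReal_lt_top) hf'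

end FunctionNorm

theorem const_mul_le_of_two_le {K C a x : ℝ≥0∞} (hK : 2 ≤ K) : C * (a * (2 * x)) ≤ K * C * a * x := by
  calc C * (a * (2 * x)) = 2 * C * a * x := by ring
    _ ≤ _ := by gcongr

theorem two_le_two_pow (d : ℕ) : (2 : ℝ≥0∞) ≤ 2 ^ (d + 5) :=
  le_self_pow₀ one_le_two (by omega)

/-- The two bounds for the compactly supported functions, for a general oscillation `O` which
dominates the weak one. -/
theorem boundedOnCompactPart (hd : 0 < d) {T : L0 d → L0 d} {φ : ℝ → ℝ}
    (hφ : MonotoneOn φ (Ici 1)) {O : L0 d → Cube d → ℝ≥0∞}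
    (hT : WeightedBound (fun w f => ⨆ Q : Cube d, essSupOn w Q * O f Q) φ T)
    {N : L0 d → (Fin d → ℝ) → ℝ≥0∞}
    (hN : N = fun f x => ⨆ Q : Cube d, Q.carrier.indicator (fun _ => O f Q) x)
    (hNm : ∀ f, Measurable (N f)) (hwk : ∀ f x, weakSharpMaximal f x ≤ N f x) (X : FunctionNorm d)
    (hM : maximalOpNorm X.toFun < ∞) (hM' : maximalOpNorm X.dual < ∞)
    (hC : sInf {C | ∀ f ∈ X.space, FiniteLevelSets f → X.norm f ≤ C * X.toFun (N f)} < ∞) :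
    BoundedOnCompactPart X T
        (2 ^ (d + 5) * sInf {C | ∀ f ∈ X.space, FiniteLevelSets f → X.norm f ≤ C * X.toFun (N f)}
          * ENNReal.ofReal (φ (2 * (maximalOpNorm X.toFun).toReal))) ∧
      BoundedOnCompactPart X T (2 ^ (d + 5) * maximalOpNorm X.dual
        * ENNReal.ofReal (φ (2 * (maximalOpNorm X.toFun).toReal))) := by
  refine ⟨fun f hf hTf => ?_, fun f hf hTf => ?_⟩ <;>
    obtain ⟨v, hv, hvX, hle⟩ := exists_majorant hd hφ hT hM hf <;>
    replace hle : ∀ᵐ x ∂volume, N (T f) x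
        ≤ ENNReal.ofReal (φ (2 * (maximalOpNorm X.toFun).toReal)) * v x := by
      rw [hN]
      exact hle
  -- The sharp constant is defined by testing on elements of `X` only. The Fefferman-Stein bound
  -- comes first because it supplies `T f ∈ X`.
  all_goals
    obtain ⟨hmem, h1⟩ := X.norm_le_of_majorant hd hM' hTf hv hf.1 hvX
      (hle.mono fun x hx => (hwk _ x).trans hx)
  · have h2 := (X.toFun_le_of_ae_le_mul (hNm (T f)) hv hle).trans (mul_le_mul_right hvX _)
    refine (X.norm_le_sInf_mul hC hmem hTf (h2.trans_lt ?_)).trans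
      ((mul_le_mul_right h2 _).trans (const_mul_le_of_two_le (two_le_two_pow d)))
    exact ENNReal.mul_lt_top ENNReal.ofReal_lt_top (ENNReal.mul_lt_top (by simp) hf.1)
  · exact h1

theorem boundedOnCompactPart_of_bmo (hd : 0 < d) {T : L0 d → L0 d} {φ : ℝ → ℝ}
    (hφ : MonotoneOn φ (Ici 1)) (hT : WeightedBound bmoNorm φ T) (X : FunctionNorm d)
    (hM : maximalOpNorm X.toFun < ∞) (hM' : maximalOpNorm X.dual < ∞) :
    BoundedOnCompactPart X T (2 ^ (d + 5) * X.sharpConst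
        * ENNReal.ofReal (φ (2 * (maximalOpNorm X.toFun).toReal))) ∧
      BoundedOnCompactPart X T (2 ^ (d + 5) * maximalOpNorm X.dual
        * ENNReal.ofReal (φ (2 * (maximalOpNorm X.toFun).toReal))) :=
  boundedOnCompactPart hd hφ hT (N := sharpMaximal) rfl measurable_sharpMaximal
    weakSharpMaximal_le_sharpMaximal X hM hM'
    (X.sharpConst_le_weakSharpConst.trans_lt (X.weakSharpConst_lt_top hd hM'))

theorem boundedOnCompactPart_of_weakBmo (hd : 0 < d) {T : L0 d → L0 d} {φ : ℝ → ℝ}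
    (hφ : MonotoneOn φ (Ici 1)) (hT : WeightedBound weakBmoNorm φ T) (X : FunctionNorm d)
    (hM : maximalOpNorm X.toFun < ∞) (hM' : maximalOpNorm X.dual < ∞) :
    BoundedOnCompactPart X T (2 ^ (d + 5) * X.weakSharpConst
        * ENNReal.ofReal (φ (2 * (maximalOpNorm X.toFun).toReal))) ∧
      BoundedOnCompactPart X T (2 ^ (d + 5) * maximalOpNorm X.dual
        * ENNReal.ofReal (φ (2 * (maximalOpNorm X.toFun).toReal))) :=
  boundedOnCompactPart hd hφ hT (N := weakSharpMaximal) rfl measurable_weakSharpMaximal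
    (fun _ _ => le_rfl) X hM hM' (X.weakSharpConst_lt_top hd hM')

/-! ### Banach function spaces as normed spaces -/

theorem measurable_enorm_L0 (f : L0 d) : Measurable fun x => ‖f x‖ₑ :=
  (AEEqFun.measurable f).enorm

namespace FunctionNorm

variable (X : FunctionNorm d)

theorem norm_mono {f g : L0 d} (h : ∀ᵐ x ∂volume, |f x| ≤ |g x|) : X.norm f ≤ X.norm g := by
  refine X.toFun_mono (measurable_enorm_L0 f) (measurable_enorm_L0 g) ?_
  filter_upwards [h] with x hx
  rw [Real.enorm_eq_ofReal_abs, Real.enorm_eq_ofReal_abs]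
  exact ENNReal.ofReal_le_ofReal hx

theorem norm_congr {f g : L0 d} (h : ∀ᵐ x ∂volume, |f x| = |g x|) : X.norm f = X.norm g :=
  le_antisymm (X.norm_mono (h.mono fun _ hx => hx.le)) (X.norm_mono (h.mono fun _ hx => hx.ge))

theorem norm_abs (f : L0 d) : X.norm |f| = X.norm f := by
  refine X.norm_congr ?_
  filter_upwards [AEEqFun.coeFn_abs f] with x hx
  rw [hx, abs_abs]

theorem norm_add_le (f g : L0 d) : X.norm (f + g) ≤ X.norm f + X.norm g := by
  refine (X.toFun_mono (measurable_enorm_L0 _)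
    ((measurable_enorm_L0 f).add (measurable_enorm_L0 g)) ?_).trans
    (X.add_le _ _ (measurable_enorm_L0 f) (measurable_enorm_L0 g))
  filter_upwards [AEEqFun.coeFn_add f g] with x hx
  rw [hx]
  exact enorm_add_le _ _

theorem norm_smul (c : ℝ) (f : L0 d) : X.norm (c • f) = ‖c‖ₑ * X.norm f := by
  refine (X.toFun_congr (measurable_enorm_L0 _) ((measurable_enorm_L0 f).const_mul _) ?_).trans
    (X.smul_eq ‖c‖₊ _ (measurable_enorm_L0 f))
  filter_upwards [AEEqFun.coeFn_smul c f] with x hx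
  rw [hx, Pi.smul_apply, smul_eq_mul, enorm_mul]
  rfl

theorem norm_sub_comm (f g : L0 d) : X.norm (f - g) = X.norm (g - f) := by
  refine X.norm_congr ?_
  filter_upwards [AEEqFun.coeFn_sub f g, AEEqFun.coeFn_sub g f] with x h1 h2
  rw [h1, h2]
  exact abs_sub_comm _ _

theorem norm_sub_le (f g h : L0 d) : X.norm (f - h) ≤ X.norm (f - g) + X.norm (g - h) := by
  rw [← sub_add_sub_cancel f g h]
  exact X.norm_add_le _ _

theorem eq_zero_of_norm_eq_zero {f : L0 d} (h : X.norm f = 0) : f = 0 := by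
  refine AEEqFun.ext ?_
  filter_upwards [(X.eq_zero_iff _ (measurable_enorm_L0 f)).1 h,
    AEEqFun.coeFn_zero (α := Fin d → ℝ) (μ := volume) (β := ℝ)] with x h1 h2
  rw [h2]
  simpa using h1

theorem eq_of_tendsto {h : ℕ → L0 d} {f g : L0 d}
    (hf : Tendsto (fun n => X.norm (h n - f)) atTop (𝓝 0))
    (hg : Tendsto (fun n => X.norm (h n - g)) atTop (𝓝 0)) : f = g := by
  rw [← sub_eq_zero]
  refine X.eq_zero_of_norm_eq_zero (le_antisymm ?_ zero_le)
  have hlim := hf.add hg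
  rw [add_zero] at hlim
  refine ge_of_tendsto' hlim fun n => ?_
  rw [X.norm_sub_comm (h n) f]
  exact X.norm_sub_le _ _ _

theorem norm_le_of_tendsto {h : ℕ → L0 d} {f : L0 d} {C : ℝ≥0∞}
    (hf : Tendsto (fun n => X.norm (h n - f)) atTop (𝓝 0)) (hC : ∀ n, X.norm (h n) ≤ C) :
    X.norm f ≤ C := by
  have hlim := hf.const_add C
  rw [add_zero] at hlim
  refine ge_of_tendsto' hlim fun n => ?_
  calc X.norm f = X.norm (h n + (f - h n)) := by rw [add_sub_cancel]
    _ ≤ X.norm (h n) + X.norm (f - h n) := X.norm_add_le _ _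
    _ ≤ C + X.norm (h n - f) := by
        rw [X.norm_sub_comm f]
        gcongr
        exact hC n

/-- The Riesz-Fischer property. -/
theorem exists_tendsto_of_cauchy {h : ℕ → L0 d} (hX : ∀ n, h n ∈ X.space)
    (hc : ∀ ε : ℝ≥0∞, 0 < ε → ∃ N, ∀ m ≥ N, ∀ n ≥ N, X.norm (h m - h n) ≤ ε) :
    ∃ g ∈ X.space, Tendsto (fun n => X.norm (h n - g)) atTop (𝓝 0) := by
  have hpow : ∀ k : ℕ, (0 : ℝ≥0∞) < 2⁻¹ ^ k := fun k => ENNReal.pow_pos (by simp) k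
  choose N hN using fun k : ℕ => hc (2⁻¹ ^ k) (hpow k)
  -- The running maximum of `N` makes index `k` valid for the tolerances of all `j ≤ k`.
  set ns : ℕ → ℕ := fun k => (Finset.range (k + 1)).sup N with hns
  have hle : ∀ j k, j ≤ k → N j ≤ ns k := fun j k hjk =>
    Finset.le_sup (f := N) (Finset.mem_range.2 (Nat.lt_succ_of_le hjk))
  set u : ℕ → (Fin d → ℝ) → ℝ≥0∞ := fun k x => ‖(h (ns k) - h (ns (k + 1))) x‖ₑ with hu
  have hum : ∀ k, Measurable (u k) := fun k => measurable_enorm_L0 _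
  have hsum : X.toFun (fun x => ∑' k, u k x) < ∞ := by
    refine (X.toFun_tsum_le hum).trans_lt ?_
    calc ∑' k, X.toFun (u k) ≤ ∑' k : ℕ, (2⁻¹ : ℝ≥0∞) ^ k :=
          ENNReal.tsum_le_tsum fun k => hN k _ (hle k k le_rfl) _ (hle k (k + 1) k.le_succ)
      _ = 2 := by rw [ENNReal.tsum_geometric, ENNReal.one_sub_inv_two, inv_inv]
      _ < ∞ := by simp
  have hconv : ∀ᵐ x ∂volume, ∃ l, Tendsto (fun k => h (ns k) x) atTop (𝓝 l) := by
    filter_upwards [X.ae_lt_top (Measurable.tsum hum) hsum,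
      ae_all_iff.2 fun k => AEEqFun.coeFn_sub (h (ns k)) (h (ns (k + 1)))] with x hx hsub
    refine cauchySeq_tendsto_of_complete
      (cauchySeq_of_edist_le_of_tsum_ne_top (fun k => u k x) (fun k => ?_) hx.ne)
    rw [edist_eq_enorm_sub]
    simp only [hu]
    rw [hsub k]
    exact le_rfl
  obtain ⟨g₀, hg₀m, hg₀⟩ := measurable_limit_of_tendsto_metrizable_ae
    (fun k => (AEEqFun.measurable (h (ns k))).aemeasurable) hconv
  set g : L0 d := AEEqFun.mk g₀ hg₀m.aestronglyMeasurable with hg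
  have hbound : ∀ j, ∀ m ≥ N j, X.norm (h m - g) ≤ 2⁻¹ ^ j := by
    intro j m hm
    refine X.toFun_le_of_tendsto (u := fun k x => ‖(h m - h (ns k)) x‖ₑ)
      (fun k => measurable_enorm_L0 _) (measurable_enorm_L0 _) ?_ ?_
    · filter_upwards [hg₀, AEEqFun.coeFn_mk g₀ hg₀m.aestronglyMeasurable, AEEqFun.coeFn_sub (h m) g,
        ae_all_iff.2 fun k => AEEqFun.coeFn_sub (h m) (h (ns k))] with x h1 h2 h3 h4
      rw [h3]
      simp only [h4, Pi.sub_apply]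
      rw [hg, h2]
      exact (tendsto_const_nhds.sub h1).enorm
    · filter_upwards [eventually_ge_atTop j] with k hk
      exact hN j m hm _ (hle j k hk)
  refine ⟨g, ?_, ?_⟩
  · have h1 : X.norm g ≤ X.norm (h (N 0)) + X.norm (h (N 0) - g) := by
      rw [X.norm_sub_comm]
      calc X.norm g = X.norm (h (N 0) + (g - h (N 0))) := by rw [add_sub_cancel]
        _ ≤ _ := X.norm_add_le _ _
    refine h1.trans_lt (ENNReal.add_lt_top.2 ⟨hX _, (hbound 0 _ le_rfl).trans_lt ?_⟩)
    simp
  · rw [ENNReal.tendsto_atTop_zero]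
    intro ε hε
    have hlim : Tendsto (fun k : ℕ => (2⁻¹ : ℝ≥0∞) ^ k) atTop (𝓝 0) :=
      ENNReal.tendsto_pow_atTop_nhds_zero_of_lt_one (by simp)
    obtain ⟨j, hj⟩ := (hlim.eventually (gt_mem_nhds hε)).exists
    exact ⟨N j, fun m hm => (hbound j m hm).trans hj.le⟩

/-- The positive part of `a' - b' - c'` is at most the sum of the three absolute errors for every
`n`, so its norm is `0`. This avoids passing to almost everywhere convergent subsequences. -/
theorem ae_le_add_of_tendsto {a b c : ℕ → L0 d} {a' b' c' : L0 d}
    (ha : Tendsto (fun n => X.norm (a n - a')) atTop (𝓝 0))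
    (hb : Tendsto (fun n => X.norm (b n - b')) atTop (𝓝 0))
    (hc : Tendsto (fun n => X.norm (c n - c')) atTop (𝓝 0))
    (h : ∀ n, ∀ᵐ x ∂volume, a n x ≤ b n x + c n x) : ∀ᵐ x ∂volume, a' x ≤ b' x + c' x := by
  set r : (Fin d → ℝ) → ℝ≥0∞ := fun x => ENNReal.ofReal (a' x - b' x - c' x) with hr
  have hrm : Measurable r := (((AEEqFun.measurable a').sub (AEEqFun.measurable b')).sub
    (AEEqFun.measurable c')).ennreal_ofReal
  have h0 : X.toFun r = 0 := by
    have hlim := (ha.add hb).add hc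
    rw [add_zero, add_zero] at hlim
    refine le_antisymm (ge_of_tendsto' hlim fun n => ?_) zero_le
    refine (X.toFun_mono hrm (((measurable_enorm_L0 (a n - a')).add
      (measurable_enorm_L0 (b n - b'))).add (measurable_enorm_L0 (c n - c'))) ?_).trans
      ((X.add_le _ _ ((measurable_enorm_L0 (a n - a')).add (measurable_enorm_L0 (b n - b')))
        (measurable_enorm_L0 (c n - c'))).trans ?_)
    · filter_upwards [h n, AEEqFun.coeFn_sub (a n) a', AEEqFun.coeFn_sub (b n) b',
        AEEqFun.coeFn_sub (c n) c'] with x h1 h2 h3 h4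
      simp only [Pi.add_apply, h2, h3, h4, Pi.sub_apply, Real.enorm_eq_ofReal_abs, hr]
      rw [← ENNReal.ofReal_add (abs_nonneg _) (abs_nonneg _), ← ENNReal.ofReal_add
        (add_nonneg (abs_nonneg _) (abs_nonneg _)) (abs_nonneg _)]
      refine ENNReal.ofReal_le_ofReal ?_
      linarith [neg_abs_le (a n x - a' x), le_abs_self (b n x - b' x),
        le_abs_self (c n x - c' x)]
    · exact add_le_add_left
        (X.add_le _ _ (measurable_enorm_L0 (a n - a')) (measurable_enorm_L0 (b n - b'))) _
  filter_upwards [(X.eq_zero_iff r hrm).1 h0] with x hx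
  have : a' x - b' x - c' x ≤ 0 := ENNReal.ofReal_eq_zero.1 hx
  linarith

end FunctionNorm

/-! ### Density of the compactly supported functions -/

/-- The characteristic function of the closed ball of radius `n`, as an element of `L⁰`. -/
def ballInd (d n : ℕ) : L0 d :=
  AEEqFun.mk ((Metric.closedBall 0 n).indicator fun _ => (1 : ℝ))
    (measurable_const.indicator Metric.isClosed_closedBall.measurableSet).aestronglyMeasurable

theorem coeFn_ballInd_mul (n : ℕ) (f : L0 d) :
    ∀ᵐ x ∂volume, (ballInd d n * f) x = (Metric.closedBall 0 (n : ℝ)).indicator f x := by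
  filter_upwards [AEEqFun.coeFn_mul (ballInd d n) f, AEEqFun.coeFn_mk
    ((Metric.closedBall (0 : Fin d → ℝ) n).indicator fun _ => (1 : ℝ))
    (measurable_const.indicator Metric.isClosed_closedBall.measurableSet).aestronglyMeasurable]
    with x h1 h2
  rw [h1, Pi.mul_apply, ballInd, h2]
  by_cases hx : x ∈ Metric.closedBall (0 : Fin d → ℝ) n
  · simp only [indicator_of_mem hx, one_mul]
  · simp only [indicator_of_notMem hx, zero_mul]

theorem ballInd_mul_add (n : ℕ) (f g : L0 d) :
    ballInd d n * (f + g) = ballInd d n * f + ballInd d n * g := by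
  refine AEEqFun.ext ?_
  filter_upwards [AEEqFun.coeFn_mul (ballInd d n) (f + g), AEEqFun.coeFn_add f g,
    AEEqFun.coeFn_add (ballInd d n * f) (ballInd d n * g), AEEqFun.coeFn_mul (ballInd d n) f,
    AEEqFun.coeFn_mul (ballInd d n) g] with x h1 h2 h3 h4 h5
  rw [h1, h3, Pi.mul_apply, Pi.add_apply, h2, h4, h5]
  exact mul_add _ _ _

theorem ballInd_mul_smul (n : ℕ) (c : ℝ) (f : L0 d) :
    ballInd d n * (c • f) = c • (ballInd d n * f) := by
  refine AEEqFun.ext ?_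
  filter_upwards [AEEqFun.coeFn_mul (ballInd d n) (c • f), AEEqFun.coeFn_smul c f,
    AEEqFun.coeFn_smul c (ballInd d n * f), AEEqFun.coeFn_mul (ballInd d n) f] with x h1 h2 h3 h4
  rw [h1, h3, Pi.mul_apply, Pi.smul_apply, h2, h4]
  exact mul_smul_comm c _ _

theorem ballInd_mul_eventually_eq {f : L0 d} (hf : CompactlySupported f) :
    ∀ᶠ n in atTop, ballInd d n * f = f := by
  obtain ⟨K, hK, hKf⟩ := hf
  obtain ⟨R, hR⟩ := hK.isBounded.subset_closedBall 0
  filter_upwards [tendsto_natCast_atTop_atTop.eventually (eventually_ge_atTop R)] with n hn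
  refine AEEqFun.ext ?_
  filter_upwards [coeFn_ballInd_mul n f, hKf] with x h1 h2
  rw [h1]
  by_cases hx : x ∈ Metric.closedBall (0 : Fin d → ℝ) n
  · rw [indicator_of_mem hx]
  · rw [indicator_of_notMem hx]
    exact (h2 fun hxK => hx (Metric.closedBall_subset_closedBall hn (hR hxK))).symm

namespace FunctionNorm

variable (X : FunctionNorm d)

theorem norm_ballInd_mul_le (n : ℕ) (f : L0 d) : X.norm (ballInd d n * f) ≤ X.norm f := by
  refine X.norm_mono ?_
  filter_upwards [coeFn_ballInd_mul n f] with x hx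
  rw [hx]
  by_cases h : x ∈ Metric.closedBall (0 : Fin d → ℝ) n
  · rw [indicator_of_mem h]
  · rw [indicator_of_notMem h, abs_zero]; exact abs_nonneg _

theorem ballInd_mul_mem {f : L0 d} (hf : f ∈ X.space) (n : ℕ) :
    ballInd d n * f ∈ X.compactPart := by
  refine ⟨(X.norm_ballInd_mul_le n f).trans_lt hf, Metric.closedBall 0 n,
    isCompact_closedBall _ _, ?_⟩
  filter_upwards [coeFn_ballInd_mul n f] with x hx h
  rw [hx, indicator_of_notMem h]

/-- The absolute errors are `|f|` restricted to the complements of the balls, which decrease to `0`.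
-/
theorem tendsto_ballInd_mul (hX : X.OrderContinuous) {f : L0 d} (hf : f ∈ X.space) :
    Tendsto (fun n => X.norm (ballInd d n * f - f)) atTop (𝓝 0) := by
  have hval : ∀ n, ∀ᵐ x ∂volume, |ballInd d n * f - f| x
      = (Metric.closedBall 0 (n : ℝ))ᶜ.indicator (fun x => |f x|) x := by
    intro n
    filter_upwards [AEEqFun.coeFn_abs (ballInd d n * f - f),
      AEEqFun.coeFn_sub (ballInd d n * f) f, coeFn_ballInd_mul n f] with x h1 h2 h3
    rw [h1, h2, Pi.sub_apply, h3]
    by_cases hx : x ∈ Metric.closedBall (0 : Fin d → ℝ) n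
    · rw [indicator_of_mem hx, indicator_of_notMem (by simpa using hx)]; simp
    · rw [indicator_of_notMem hx, indicator_of_mem (by exact hx)]; simp
  have h := hX (fun n => |ballInd d n * f - f|) (fun n => ?_) ?_ ?_
  · simpa only [X.norm_abs] using h
  · change X.norm _ < ∞
    rw [X.norm_abs]
    exact X.space.sub_mem (X.ballInd_mul_mem hf n).1 hf
  · refine antitone_nat_of_succ_le fun n => AEEqFun.coeFn_le.1 ?_
    filter_upwards [hval n, hval (n + 1)] with x h1 h2
    rw [h1, h2]
    refine indicator_le_indicator_of_subset (compl_subset_compl.2 ?_) (fun _ => abs_nonneg _) x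
    exact Metric.closedBall_subset_closedBall (by simp)
  · filter_upwards [ae_all_iff.2 hval] with x hx
    refine tendsto_const_nhds.congr' ?_
    filter_upwards [tendsto_natCast_atTop_atTop.eventually (eventually_ge_atTop ‖x‖)] with n hn
    rw [hx n, indicator_of_notMem (by simpa using hn)]

/-! ### Extension by density -/

/-- Only a Lipschitz bound is required of `V`, so that it can be `T` in the linear case and `|T|` in
the sublinear case. -/
theorem exists_tendsto_apply_ballInd_mul (hX : X.OrderContinuous) {V : L0 d → L0 d} {B : ℝ≥0∞}
    (hB : B < ∞) (hV : ∀ f ∈ X.compactPart, V f ∈ X.space)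
    (hLip : ∀ f ∈ X.compactPart, ∀ g ∈ X.compactPart, X.norm (V f - V g) ≤ B * X.norm (f - g))
    {f : L0 d} (hf : f ∈ X.space) :
    ∃ g ∈ X.space, Tendsto (fun n => X.norm (V (ballInd d n * f) - g)) atTop (𝓝 0) := by
  refine X.exists_tendsto_of_cauchy (fun n => hV _ (X.ballInd_mul_mem hf n)) fun ε hε => ?_
  have hlim : Tendsto (fun n => B * X.norm (ballInd d n * f - f)) atTop (𝓝 (B * 0)) :=
    ENNReal.Tendsto.const_mul (X.tendsto_ballInd_mul hX hf) (Or.inr hB.ne)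
  rw [mul_zero, ENNReal.tendsto_atTop_zero] at hlim
  obtain ⟨N, hN⟩ := hlim (ε / 2) (ENNReal.half_pos hε.ne')
  refine ⟨N, fun m hm n hn => ?_⟩
  refine (hLip _ (X.ballInd_mul_mem hf m) _ (X.ballInd_mul_mem hf n)).trans ?_
  calc B * X.norm (ballInd d m * f - ballInd d n * f)
      ≤ B * (X.norm (ballInd d m * f - f) + X.norm (f - ballInd d n * f)) := by
        gcongr
        exact X.norm_sub_le _ _ _
    _ = B * X.norm (ballInd d m * f - f) + B * X.norm (ballInd d n * f - f) := by
        rw [mul_add, X.norm_sub_comm f]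
    _ ≤ ε / 2 + ε / 2 := add_le_add (hN m hm) (hN n hn)
    _ = ε := ENNReal.add_halves ε

theorem compactPart_sub {f g : L0 d} (hf : f ∈ X.compactPart) (hg : g ∈ X.compactPart) :
    f - g ∈ X.compactPart := by
  refine ⟨X.space.sub_mem hf.1 hg.1, ?_⟩
  obtain ⟨K, hK, hKf⟩ := hf.2
  obtain ⟨L, hL, hLg⟩ := hg.2
  refine ⟨K ∪ L, hK.union hL, ?_⟩
  filter_upwards [hKf, hLg, AEEqFun.coeFn_sub f g] with x h1 h2 h3 hx
  rw [mem_union, not_or] at hx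
  rw [h3, Pi.sub_apply, h1 hx.1, h2 hx.2, sub_zero]

end FunctionNorm

theorem extends_linear {X : FunctionNorm d} {T : L0 d → L0 d} {B B' : ℝ≥0∞} (hB' : B' < ∞)
    (h : BoundedOnCompactPart X T B) (h' : BoundedOnCompactPart X T B')
    (hX : X.OrderContinuous) (hfin : ∀ f ∈ X.compactPart, FiniteLevelSets (T f))
    (hT : LinearOn T X.compactPart) :
    ∃ S : X.space →ₗ[ℝ] X.space,
      (∀ f : X.space, CompactlySupported (f : L0 d) → (S f : L0 d) = T f) ∧
      ∀ f : X.space, X.norm (S f) ≤ B * X.norm f ∧ X.norm (S f) ≤ B' * X.norm f := by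
  have hmem : ∀ f ∈ X.compactPart, T f ∈ X.space := fun f hf =>
    (h' f hf (hfin f hf)).trans_lt (ENNReal.mul_lt_top hB' hf.1)
  have hsub : ∀ f ∈ X.compactPart, ∀ g ∈ X.compactPart, T f - T g = T (f - g) := by
    intro f hf g hg
    rw [sub_eq_iff_eq_add, ← hT.1 _ (X.compactPart_sub hf hg) _ hg, sub_add_cancel]
  have hex := fun f : X.space => X.exists_tendsto_apply_ballInd_mul hX hB' hmem
    (fun f hf g hg => by
      rw [hsub f hf g hg]
      exact h' _ (X.compactPart_sub hf hg) (hfin _ (X.compactPart_sub hf hg))) f.2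
  choose L hLX hL using hex
  refine ⟨⟨⟨fun f => ⟨L f, hLX f⟩, fun f g => Subtype.ext ?_⟩, fun c f => Subtype.ext ?_⟩,
    fun f hf => ?_, fun f => ⟨?_, ?_⟩⟩
  · refine X.eq_of_tendsto (hL (f + g)) ?_
    have hlim := (hL f).add (hL g)
    rw [add_zero] at hlim
    refine tendsto_of_tendsto_of_tendsto_of_le_of_le tendsto_const_nhds hlim (fun n => zero_le)
      fun n => ?_
    rw [Submodule.coe_add, ballInd_mul_add, hT.1 _ (X.ballInd_mul_mem f.2 n) _ (X.ballInd_mul_mem g.2 n),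
      Submodule.coe_add, add_sub_add_comm]
    exact X.norm_add_le _ _
  · refine X.eq_of_tendsto (hL (c • f)) ?_
    have hlim := ENNReal.Tendsto.const_mul (a := ‖c‖ₑ) (hL f) (Or.inr enorm_ne_top)
    rw [mul_zero] at hlim
    refine hlim.congr fun n => ?_
    rw [Submodule.coe_smul, ballInd_mul_smul, hT.2 c _ (X.ballInd_mul_mem f.2 n), RingHom.id_apply,
      Submodule.coe_smul, ← smul_sub, X.norm_smul]
  · refine X.eq_of_tendsto (hL f) (tendsto_const_nhds.congr' ?_)
    filter_upwards [ballInd_mul_eventually_eq hf] with n hn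
    have h0 : X.norm 0 = 0 := by simpa using X.norm_smul 0 0
    rw [hn, sub_self, h0]
  · refine X.norm_le_of_tendsto (hL f) fun n => ?_
    have hn := X.ballInd_mul_mem f.2 n
    exact (h _ hn (hfin _ hn)).trans (mul_le_mul_right (X.norm_ballInd_mul_le n f) _)
  · refine X.norm_le_of_tendsto (hL f) fun n => ?_
    have hn := X.ballInd_mul_mem f.2 n
    exact (h' _ hn (hfin _ hn)).trans (mul_le_mul_right (X.norm_ballInd_mul_le n f) _)

/-- Sublinearity bounds `||Tf| - |Tg||` by `|T(f - g)|` but says nothing about `Tf - Tg`, as signs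
are not controlled. Hence the limit of `|T|` along the cut-offs is used, except on compactly
supported functions, where `S` must equal `T` itself. Sublinearity of `S` involves only `|S|`, which
is that limit in both cases. -/
theorem extends_sublinear {X : FunctionNorm d} {T : L0 d → L0 d} {B B' : ℝ≥0∞} (hB' : B' < ∞)
    (h : BoundedOnCompactPart X T B) (h' : BoundedOnCompactPart X T B')
    (hX : X.OrderContinuous) (hfin : ∀ f ∈ X.compactPart, FiniteLevelSets (T f))
    (hT : SublinearOn T X.compactPart) :
    ∃ S : L0 d → L0 d, SublinearOn S X.space ∧ (∀ f ∈ X.space, S f ∈ X.space) ∧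
      (∀ f ∈ X.compactPart, S f = T f) ∧
      ∀ f ∈ X.space, X.norm (S f) ≤ B * X.norm f ∧ X.norm (S f) ≤ B' * X.norm f := by
  classical
  have hmem : ∀ f ∈ X.compactPart, |T f| ∈ X.space := fun f hf => by
    change X.norm _ < ∞
    rw [X.norm_abs]
    exact (h' f hf (hfin f hf)).trans_lt (ENNReal.mul_lt_top hB' hf.1)
  have habs : ∀ f ∈ X.compactPart, ∀ g ∈ X.compactPart,
      ∀ᵐ x ∂volume, |T f x| ≤ |T (f - g) x| + |T g x| := by
    intro f hf g hg
    have := hT.1 _ (X.compactPart_sub hf hg) _ hg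
    rwa [sub_add_cancel] at this
  have hsub : ∀ f ∈ X.compactPart, ∀ g ∈ X.compactPart,
      X.norm (|T f| - |T g|) ≤ X.norm (T (f - g)) := by
    intro f hf g hg
    refine X.norm_mono ?_
    have hneg : ∀ᵐ x ∂volume, |T (g - f) x| = |T (f - g) x| := by
      have := hT.2 (-1) _ (X.compactPart_sub hf hg)
      rw [neg_smul, one_smul, neg_sub] at this
      simpa using this
    filter_upwards [habs f hf g hg, habs g hg f hf, hneg, AEEqFun.coeFn_sub |T f| |T g|,
      AEEqFun.coeFn_abs (T f), AEEqFun.coeFn_abs (T g)] with x h1 h2 h3 h4 h5 h6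
    rw [h4, Pi.sub_apply, h5, h6, abs_le]
    rw [h3] at h2
    constructor <;> linarith
  have hex := fun (f : L0 d) (hf : f ∈ X.space) =>
    X.exists_tendsto_apply_ballInd_mul (V := fun f => |T f|) hX hB' hmem
    (fun f hf g hg => (hsub f hf g hg).trans
      (h' _ (X.compactPart_sub hf hg) (hfin _ (X.compactPart_sub hf hg)))) hf
  choose! L hLX hL using hex
  set S : L0 d → L0 d := fun f => if CompactlySupported f then T f else L f with hS
  have hST : ∀ f, CompactlySupported f → S f = T f := fun f hf => if_pos hf
  have hlim : ∀ f ∈ X.space,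
      Tendsto (fun n => X.norm (|T (ballInd d n * f)| - |S f|)) atTop (𝓝 0) := by
    intro f hf
    by_cases hc : CompactlySupported f
    · refine tendsto_const_nhds.congr' ?_
      filter_upwards [ballInd_mul_eventually_eq hc] with n hn
      have h0 : X.norm 0 = 0 := by simpa using X.norm_smul 0 0
      rw [hn, hST f hc, sub_self, h0]
    · have hSL : S f = L f := if_neg hc
      refine tendsto_of_tendsto_of_tendsto_of_le_of_le tendsto_const_nhds (hL f hf)
        (fun n => zero_le) fun n => X.norm_mono ?_
      set t := T (ballInd d n * f)
      filter_upwards [AEEqFun.coeFn_sub |t| |S f|, AEEqFun.coeFn_sub |t| (L f),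
        AEEqFun.coeFn_abs t, AEEqFun.coeFn_abs (S f)] with x h1 h2 h3 h4
      rw [h1, h2, Pi.sub_apply, Pi.sub_apply, h3, h4, hSL]
      simpa using abs_abs_sub_abs_le |t x| (L f x)
  have hbound : ∀ C, BoundedOnCompactPart X T C → ∀ f ∈ X.space, X.norm (S f) ≤ C * X.norm f := by
    intro C hC f hf
    rw [← X.norm_abs]
    refine X.norm_le_of_tendsto (hlim f hf) fun n => ?_
    have hn := X.ballInd_mul_mem hf n
    rw [X.norm_abs]
    exact (hC _ hn (hfin _ hn)).trans (mul_le_mul_right (X.norm_ballInd_mul_le n f) _)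
  refine ⟨S, ⟨fun f hf g hg => ?_, fun c f hf => ?_⟩, fun f hf => ?_, fun f hf => hST f hf.2,
    fun f hf => ⟨hbound B h f hf, hbound B' h' f hf⟩⟩
  · have hle := X.ae_le_add_of_tendsto (hlim _ (X.space.add_mem hf hg)) (hlim f hf) (hlim g hg)
      fun n => ?_
    · filter_upwards [hle, AEEqFun.coeFn_abs (S (f + g)), AEEqFun.coeFn_abs (S f),
        AEEqFun.coeFn_abs (S g)] with x h1 h2 h3 h4
      rwa [h2, h3, h4] at h1
    · filter_upwards [hT.1 _ (X.ballInd_mul_mem hf n) _ (X.ballInd_mul_mem hg n),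
        AEEqFun.coeFn_abs (T (ballInd d n * (f + g))), AEEqFun.coeFn_abs (T (ballInd d n * f)),
        AEEqFun.coeFn_abs (T (ballInd d n * g))] with x h1 h2 h3 h4
      rw [h2, h3, h4, ballInd_mul_add]
      exact h1
  · have heq : |S (c • f)| = |c| • |S f| := by
      refine X.eq_of_tendsto (hlim _ (X.space.smul_mem c hf)) ?_
      have hl := ENNReal.Tendsto.const_mul (a := ‖|c|‖ₑ) (hlim f hf) (Or.inr enorm_ne_top)
      rw [mul_zero] at hl
      refine hl.congr fun n => ?_
      rw [← X.norm_smul, smul_sub]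
      congr 2
      refine AEEqFun.ext ?_
      rw [ballInd_mul_smul]
      filter_upwards [hT.2 c _ (X.ballInd_mul_mem hf n),
        AEEqFun.coeFn_abs (T (c • (ballInd d n * f))),
        AEEqFun.coeFn_smul |c| |T (ballInd d n * f)|,
        AEEqFun.coeFn_abs (T (ballInd d n * f))] with x h1 h2 h3 h4
      rw [h2, h3, Pi.smul_apply, h4, h1, smul_eq_mul]
    filter_upwards [AEEqFun.coeFn_abs (S (c • f)), AEEqFun.coeFn_smul |c| |S f|,
      AEEqFun.coeFn_abs (S f)] with x h1 h2 h3
    rw [← h1, heq, h2, Pi.smul_apply, h3, smul_eq_mul]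
  · exact (hbound B' h' f hf).trans_lt (ENNReal.mul_lt_top hB' hf)

theorem extendsBoundedly {X : FunctionNorm d} {T : L0 d → L0 d} {B B' : ℝ≥0∞} (hB' : B' < ∞)
    (h : BoundedOnCompactPart X T B) (h' : BoundedOnCompactPart X T B') :
    ExtendsBoundedly X T B B' := fun hX hfin =>
  ⟨extends_sublinear hB' h h' hX hfin, extends_linear hB' h h' hX hfin⟩

end BMOExtrapolation

end

/-! ### The theorem -/

open BMOExtrapolation
theorem theorem3p1 (d : ℕ) (hd : 0 < d) :
    ∃ K : ℝ≥0, ∀ (T : L0 d → L0 d) (φ : ℝ → ℝ),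
      MonotoneOn φ (Ici 1) → (∀ t ∈ Ici (1 : ℝ), 0 < φ t) →
      (WeightedBound bmoNorm φ T →
        ∀ X : FunctionNorm d, maximalOpNorm X.toFun < ∞ → maximalOpNorm X.dual < ∞ →
          X.sharpConst < ∞ ∧
          BoundedOnCompactPart X T
            (K * X.sharpConst * ENNReal.ofReal (φ (2 * (maximalOpNorm X.toFun).toReal))) ∧
          BoundedOnCompactPart X T
            (K * maximalOpNorm X.dual *
              ENNReal.ofReal (φ (2 * (maximalOpNorm X.toFun).toReal))) ∧
          ExtendsBoundedly X T
            (K * X.sharpConst * ENNReal.ofReal (φ (2 * (maximalOpNorm X.toFun).toReal)))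
            (K * maximalOpNorm X.dual *
              ENNReal.ofReal (φ (2 * (maximalOpNorm X.toFun).toReal)))) ∧
      (WeightedBound weakBmoNorm φ T →
        ∀ X : FunctionNorm d, maximalOpNorm X.toFun < ∞ → maximalOpNorm X.dual < ∞ →
          X.weakSharpConst < ∞ ∧
          BoundedOnCompactPart X T
            (K * X.weakSharpConst * ENNReal.ofReal (φ (2 * (maximalOpNorm X.toFun).toReal))) ∧
          BoundedOnCompactPart X T
            (K * maximalOpNorm X.dual *
              ENNReal.ofReal (φ (2 * (maximalOpNorm X.toFun).toReal))) ∧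
          ExtendsBoundedly X T
            (K * X.weakSharpConst * ENNReal.ofReal (φ (2 * (maximalOpNorm X.toFun).toReal)))
            (K * maximalOpNorm X.dual *
              ENNReal.ofReal (φ (2 * (maximalOpNorm X.toFun).toReal)))) := by
  -- The factor `2^(d+4)` comes from the Fefferman-Stein inequality, and a further `2` from the norm
  -- of the Rubio de Francia majorant.
  refine ⟨2 ^ (d + 5), fun T φ hφ _ => ?_⟩
  have hfin : ∀ {a : ℝ≥0∞} {b : ℝ}, a < ∞ → 2 ^ (d + 5) * a * ENNReal.ofReal b < ∞ := fun ha =>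
    ENNReal.mul_lt_top (ENNReal.mul_lt_top (ENNReal.pow_lt_top (by simp)) ha) ENNReal.ofReal_lt_top
  push_cast
  refine ⟨fun hT X hM hM' => ?_, fun hT X hM hM' => ?_⟩
  · obtain ⟨h, h'⟩ := boundedOnCompactPart_of_bmo hd hφ hT X hM hM'
    exact ⟨X.sharpConst_le_weakSharpConst.trans_lt (X.weakSharpConst_lt_top hd hM'), h, h',
      extendsBoundedly (hfin hM') h h'⟩
  · obtain ⟨h, h'⟩ := boundedOnCompactPart_of_weakBmo hd hφ hT X hM hM'
    exact ⟨X.weakSharpConst_lt_top hd hM', h, h', extendsBoundedly (hfin hM') h h'⟩
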